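/- Let $V$ be a finite-dimensional Hermitian vector space of complex dimension $n$, with volume form $\omega_V=\left(\frac{i}{2\pi}\partial\bar\partial\|z\|^2\right)^n$, let $\Omega\subset V$ be a domain, and let $p:\Omega\to(0,\infty)$ be continuous. For $k\ge 0$ let $K_{\Omega,p^k}(z,w)$ be the weighted Bergman kernel of $(\Omega,p^k)$, that is, the reproducing kernel of the space of holomorphic functions $f$ on $\Omega$ with $\int_\Omega|f|^2p^k\,\omega_V<\infty$. The virtual Bergman kernel of $(\Omega,p)$ is $$L_0(z,w;r)=\sum_{k=0}^\infty K_{\Omega,p^k}(z,w)\,r^k ,\qquad \mathcal L_0(z,r)=L_0(z,z;r).$$ For $m\ge 1$ let $$\widehat\Omega_m=\{(z,Z)\in\Omega\times\mathbb C^m:\ \|Z\|^2<p(z)\},$$ where $\|\cdot\|$ is the norm of the standard Hermitian product $\langle Z,W\rangle=\sum_j Z_j\overline{W_j}$, and let $\widehat K_m$ be its Bergman kernel, that is, the reproducing kernel of the space of holomorphic functions on $\widehat\Omega_m$ that are square-integrable with respect to $\omega_V(z)\wedge\omega_m(Z)$, $\omega_m(Z)=\left(\frac{i}{2\pi}\partial\bar\partial\|Z\|^2\right)^m$.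 Put $$L_m(z,w;r)=\frac1{m!}\frac{\partial^m}{\partial r^m}L_0(z,w;r),\qquad \mathcal L_m(z,r)=\frac1{m!}\frac{\partial^m}{\partial r^m}\mathcal L_0(z,r).$$ Then all these Bergman kernels exist, and for all $(z,Z),(w,W)\in\widehat\Omega_m$ the series $L_0(z,w;r)$ converges for all complex $r$ in a neighbourhood of $\langle Z,W\rangle$, its sum is analytic at $r=\langle Z,W\rangle$, and $$\widehat K_m\big((z,Z),(w,W)\big)=L_m\big(z,w;\langle Z,W\rangle\big)=\sum_{k=0}^\infty\binom{k+m}{m}K_{\Omega,p^{k+m}}(z,w)\,\langle Z,W\rangle^k ,$$ the last series being convergent. In particular, on the diagonal, $\widehat K_m\big((z,Z),(z,Z)\big)=\mathcal L_m\big(z,\|Z\|^2\big)$, with $r$ a real variable in the definition of $\mathcal L_m$. -/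

import Mathlib

open MeasureTheory Topology
open scoped ComplexConjugate

noncomputable section

/-- The volume form `ω_V = ((i / 2π) ∂∂̄ ‖z‖²) ^ n` of a Hermitian vector space `V` of complex
dimension `n`, as a measure. In orthonormal coordinates `z_j = x_j + i y_j` one has
`(i / 2π) ∂∂̄ ‖z‖² = ∑ j, (1 / π) dx_j ∧ dy_j`, so its `n`-th exterior power is `n! / π ^ n` times
the Euclidean (Lebesgue) volume of the real inner product space underlying `V`. -/
def hermitianVolume (V : Type*) [NormedAddCommGroup V] [InnerProductSpace ℂ V]
    [FiniteDimensional ℂ V] [MeasurableSpace V] [BorelSpace V] : Measure V :=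
  letI : InnerProductSpace ℝ V := InnerProductSpace.rclikeToReal ℂ V
  haveI : FiniteDimensional ℝ V := FiniteDimensional.complexToReal V
  ENNReal.ofReal ((Module.finrank ℂ V).factorial / Real.pi ^ Module.finrank ℂ V) •
    (volume : Measure V)

/-- Membership in the weighted Bergman space `H(D, q)` with respect to the measure `μ`:
`f` is holomorphic on the open set `D` and `∫_D |f|² q dμ < ∞`. Only the values of `f` and `q`
on `D` matter. -/
def MemBergman {E : Type*} [NormedAddCommGroup E] [NormedSpace ℂ E] [MeasurableSpace E]
    (μ : Measure E) (D : Set E) (q : E → ℝ) (f : E → ℂ) : Prop :=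
  DifferentiableOn ℂ f D ∧ IntegrableOn (fun x => ‖f x‖ ^ 2 * q x) D μ

/-- `K` is a reproducing kernel of the weighted Bergman space `H(D, q)`: for every `y ∈ D` the
function `K(·, y)` belongs to `H(D, q)`, and `f(y) = (f | K(·, y))` for all `f ∈ H(D, q)`.
These properties determine `K` on `D × D`. -/
def IsBergmanKernel {E : Type*} [NormedAddCommGroup E] [NormedSpace ℂ E] [MeasurableSpace E]
    (μ : Measure E) (D : Set E) (q : E → ℝ) (K : E → E → ℂ) : Prop :=
  ∀ y ∈ D, MemBergman μ D q (fun x => K x y) ∧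
    ∀ f : E → ℂ, MemBergman μ D q f → f y = ∫ x in D, f x * conj (K x y) * (q x : ℂ) ∂μ

open Classical in
/-- The (weighted) Bergman kernel of `D` with weight `q`: the reproducing kernel of `H(D, q)`
(zero should there be none). Its values off `D × D` are irrelevant. -/
def bergmanKernel {E : Type*} [NormedAddCommGroup E] [NormedSpace ℂ E] [MeasurableSpace E]
    (μ : Measure E) (D : Set E) (q : E → ℝ) : E → E → ℂ :=
  if h : ∃ K : E → E → ℂ, IsBergmanKernel μ D q K then h.choose else 0

section Hermitian

variable {V : Type*} [NormedAddCommGroup V] [InnerProductSpace ℂ V]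
  [FiniteDimensional ℂ V] [MeasurableSpace V] [BorelSpace V]

/-- The kernel `K_{Ω, p ^ k}(z, w)`. -/
def powerKernel (Ω : Set V) (p : V → ℝ) (k : ℕ) : V → V → ℂ :=
  bergmanKernel (hermitianVolume V) Ω (fun z => p z ^ k)

/-- The virtual Bergman kernel `L₀(z, w; r) = ∑ k, K_{Ω, p ^ k}(z, w) r ^ k` of `(Ω, p)`. -/
def virtualBergmanKernel (Ω : Set V) (p : V → ℝ) (z w : V) (r : ℂ) : ℂ :=
  ∑' k : ℕ, powerKernel Ω p k z w * r ^ k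

/-- `L_m(z, w; r) = (1 / m!) ∂^m/∂r^m L₀(z, w; r)`, with `r` a complex variable. -/
def virtualBergmanDeriv (Ω : Set V) (p : V → ℝ) (m : ℕ) (z w : V) (r : ℂ) : ℂ :=
  (1 / (m.factorial : ℂ)) * iteratedDeriv m (fun s : ℂ => virtualBergmanKernel Ω p z w s) r

/-- The virtual Bergman kernel on the diagonal, `𝓛₀(z, r) = L₀(z, z; r)`, with `r` real. -/
def diagVirtualBergmanKernel (Ω : Set V) (p : V → ℝ) (z : V) (r : ℝ) : ℂ :=
  virtualBergmanKernel Ω p z z (r : ℂ)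

/-- `𝓛_m(z, r) = (1 / m!) ∂^m/∂r^m 𝓛₀(z, r)`, with `r` a real variable. -/
def diagVirtualBergmanDeriv (Ω : Set V) (p : V → ℝ) (m : ℕ) (z : V) (r : ℝ) : ℂ :=
  (1 / (m.factorial : ℂ)) * iteratedDeriv m (fun s : ℝ => diagVirtualBergmanKernel Ω p z s) r

/-- The inflated domain `{(z, Z) ∈ Ω × ℂ^m | ‖Z‖² < p(z)}`. -/
def inflatedDomain (Ω : Set V) (p : V → ℝ) (m : ℕ) : Set (V × EuclideanSpace ℂ (Fin m)) :=
  {x | x.1 ∈ Ω ∧ ‖x.2‖ ^ 2 < p x.1}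

/-- The volume form `ω_V(z) ∧ ω_m(Z)` on `V × ℂ^m`, as a measure. -/
def inflatedVolume (V : Type*) [NormedAddCommGroup V] [InnerProductSpace ℂ V]
    [FiniteDimensional ℂ V] [MeasurableSpace V] [BorelSpace V] (m : ℕ) :
    Measure (V × EuclideanSpace ℂ (Fin m)) :=
  (hermitianVolume V).prod (hermitianVolume (EuclideanSpace ℂ (Fin m)))

/-- The unweighted Bergman kernel of the inflated domain. -/
def inflatedBergmanKernel (Ω : Set V) (p : V → ℝ) (m : ℕ) :
    V × EuclideanSpace ℂ (Fin m) → V × EuclideanSpace ℂ (Fin m) → ℂ :=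
  bergmanKernel (inflatedVolume V m) (inflatedDomain Ω p m) (fun _ => 1)

end Hermitian

end

/-!
The fibres of the inflated domain are balls centred at `0`, so a square-integrable holomorphic `f`
is the sum of its components `f_k(z, Z)` homogeneous of degree `k` in `Z`, each obtained from `f` by
averaging over the circle action on the fibre. On `ℂ ^ m` the Bargmann-Fock reproducing property,
written in polar coordinates, gives for `h` holomorphic and homogeneous of degree `k`
`(k + m).choose m * ∫_{‖Z‖² < ρ} h(Z) ⟨W, Z⟩ ^ k ω_m(Z) = ρ ^ (k + m) * h(W)`. With `ρ = p(z)` the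
weight `p ^ (k + m)` appears, and integrating over `Ω` against `K_{Ω, p ^ (k + m)}` shows that
`(k + m).choose m * K_{Ω, p ^ (k + m)}(z, w) * ⟨Z, W⟩ ^ k` is the degree `k` component of the
Bergman kernel of the inflated domain. The case `m = 1`, at points with real nonnegative fibre
coordinates, bounds the radius of convergence of `L₀(z, w; ·)` below by `√(p(z) p(w))`.
-/

section ComplexAnalysis

open Metric Filter Asymptotics

variable {E F ι : Type*} [NormedAddCommGroup E] [NormedSpace ℂ E]
  [NormedAddCommGroup F] [NormedSpace ℂ F]

theorem norm_fderiv_le_of_forall_norm_le {f : E → F} {c : E} {r M : ℝ} (hr : 0 < r)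
    (hf : DifferentiableOn ℂ f (ball c r)) (hM : ∀ x ∈ ball c r, ‖f x‖ ≤ M) :
    ‖fderiv ℂ f c‖ ≤ 2 * M / r := by
  refine Complex.norm_fderiv_le_div_of_mapsTo_ball hf (fun x hx => ?_) hr
  rw [mem_closedBall, dist_eq_norm, two_mul]
  exact (norm_sub_le _ _).trans (add_le_add (hM x hx) (hM c (mem_ball_self hr)))

theorem norm_sub_sub_fderiv_le_of_forall_norm_le {f : E → F} {c x : E} {r M : ℝ}
    (hf : DifferentiableOn ℂ f (ball c r)) (hM : ∀ x ∈ ball c r, ‖f x‖ ≤ M) (hx : x ∈ ball c r) :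
    ‖f x - f c - fderiv ℂ f c (x - c)‖ ≤ 4 * M * (‖x - c‖ / r) ^ 2 := by
  have hr : 0 < r := pos_of_mem_ball hx
  set g : E → F := fun x => f x - f c - fderiv ℂ f c (x - c)
  have hgc : g c = 0 := by simp [g]
  have hg : DifferentiableOn ℂ g (ball c r) := by fun_prop
  have hgM : Set.MapsTo g (ball c r) (closedBall (g c) (4 * M)) := fun y hy => by
    have hfd : ‖fderiv ℂ f c (y - c)‖ ≤ 2 * M := calc
      _ ≤ 2 * M / r * r := (fderiv ℂ f c).le_of_opNorm_le_of_le
          (norm_fderiv_le_of_forall_norm_le hr hf hM) (mem_ball_iff_norm.1 hy).le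
      _ = 2 * M := div_mul_cancel₀ _ hr.ne'
    have hsub := norm_sub_le (f y - f c) (fderiv ℂ f c (y - c))
    have hsub' := norm_sub_le (f y) (f c)
    rw [hgc, mem_closedBall_zero_iff]
    linarith [hM y hy, hM c (mem_ball_self hr)]
  have ho : (g · - g c) =o[𝓝 c] fun x => ‖x - c‖ ^ 1 := by
    simp only [hgc, sub_zero, pow_one]
    exact (hf.hasFDerivAt (ball_mem_nhds c hr)).isLittleO.norm_right
  simpa only [hgc, dist_eq_norm, sub_zero] using
    Complex.dist_le_mul_div_pow_of_mapsTo_ball_of_isLittleO hg hgM ho hx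

theorem uniformCauchySeqOn_fderiv {l : Filter ι} {f : ι → E → F} {U V : Set E} {r : ℝ}
    (hf : ∀ᶠ n in l, DifferentiableOn ℂ (f n) U) (hfU : UniformCauchySeqOn f l U) (hr : 0 < r)
    (hVU : ∀ y ∈ V, ball y r ⊆ U) :
    UniformCauchySeqOn (fun n => fderiv ℂ (f n)) l V := by
  intro u hu
  obtain ⟨ε, hε, hεu⟩ := Metric.mem_uniformity_dist.1 hu
  filter_upwards [hfU _ (Metric.dist_mem_uniformity (show 0 < ε * r / 4 by positivity)),
    hf.prod_mk hf] with n hn hd y hy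
  have hnhds : U ∈ 𝓝 y := mem_of_superset (ball_mem_nhds y hr) (hVU y hy)
  refine hεu ?_
  rw [dist_eq_norm, ← fderiv_sub (hd.1.differentiableAt hnhds) (hd.2.differentiableAt hnhds)]
  calc _ ≤ 2 * (ε * r / 4) / r :=
        norm_fderiv_le_of_forall_norm_le hr ((hd.1.sub hd.2).mono (hVU y hy))
          fun z hz => by simpa [dist_eq_norm] using (hn z (hVU y hy hz)).le
    _ < ε := by field_simp; norm_num

theorem differentiableOn_of_tendstoUniformlyOn [CompleteSpace F] {l : Filter ι} [l.NeBot]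
    {f : ι → E → F} {g : E → F} {U : Set E} (hU : IsOpen U)
    (hf : ∀ᶠ n in l, DifferentiableOn ℂ (f n) U) (hg : TendstoUniformlyOn f g l U) :
    DifferentiableOn ℂ g U := by
  intro x hx
  obtain ⟨r, hr, hrU⟩ := Metric.isOpen_iff.1 hU x hx
  have hr2 : 0 < r / 2 := half_pos hr
  have hsub : ∀ y ∈ ball x (r / 2), ball y (r / 2) ⊆ U := fun y hy =>
    (ball_subset_ball' (by rw [mem_ball] at hy; linarith)).trans hrU
  have hC := uniformCauchySeqOn_fderiv hf hg.uniformCauchySeqOn hr2 hsub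
  choose! g' hg' using fun y (hy : y ∈ ball x (r / 2)) =>
    CompleteSpace.complete (hC.cauchy_map hy)
  have hlim : TendstoUniformlyOnFilter (fun n => fderiv ℂ (f n)) g' l (𝓝 x) := by
    simpa [isOpen_ball.nhdsWithin_eq (mem_ball_self hr2)] using
      tendstoLocallyUniformlyOn_iff_filter.1
        (hC.tendstoUniformlyOn_of_tendsto hg').tendstoLocallyUniformlyOn x (mem_ball_self hr2)
  refine (hasFDerivAt_of_tendstoUniformlyOnFilter (f := f) hlim ?_
    ?_).differentiableAt.differentiableWithinAt
  · filter_upwards [hf.prod_mk (hU.mem_nhds hx |> eventually_mem_nhds_iff.2)] with p hp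
    exact (hp.1.differentiableAt hp.2).hasFDerivAt
  · filter_upwards [hU.mem_nhds hx] with y hy
    exact hg.tendsto_at hy

theorem tendstoUniformlyOn_slope_fderiv {f : E → F} {U : Set E} {r M : ℝ} (hr : 0 < r)
    (hf : ∀ x ∈ U, DifferentiableOn ℂ f (ball x r)) (hM : ∀ x ∈ U, ∀ y ∈ ball x r, ‖f y‖ ≤ M)
    (v : E) :
    TendstoUniformlyOn (fun (h : ℂ) x => h⁻¹ • (f (x + h • v) - f x)) (fun x => fderiv ℂ f x v)
      (𝓝[≠] 0) U := by
  set C : ℝ := 4 * M * (‖v‖ / r) ^ 2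
  have hsmall : Tendsto (fun h : ℂ => C * ‖h‖) (𝓝[≠] 0) (𝓝 0) :=
    tendsto_nhdsWithin_of_tendsto_nhds ((by fun_prop : Continuous _).tendsto' 0 0 (by simp))
  have hin : ∀ᶠ h : ℂ in 𝓝[≠] 0, ‖h • v‖ < r :=
    tendsto_nhdsWithin_of_tendsto_nhds ((by fun_prop : Continuous _).tendsto' 0 0 (by simp))
      |>.eventually_lt_const hr
  rw [Metric.tendstoUniformlyOn_iff]
  intro ε hε
  filter_upwards [hsmall.eventually_lt_const hε, hin, self_mem_nhdsWithin] with h hhε hhr hh0 x hx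
  have hh : 0 < ‖h‖ := norm_pos_iff.2 hh0
  have htaylor := norm_sub_sub_fderiv_le_of_forall_norm_le (x := x + h • v) (hf x hx) (hM x hx)
    (by simpa using hhr)
  rw [add_sub_cancel_left, map_smul] at htaylor
  calc dist (fderiv ℂ f x v) (h⁻¹ • (f (x + h • v) - f x))
      = ‖h‖⁻¹ * ‖f (x + h • v) - f x - h • fderiv ℂ f x v‖ := by
        rw [dist_comm, dist_eq_norm, ← norm_inv, ← norm_smul, smul_sub _ _ (h • _),
          inv_smul_smul₀ hh0]
    _ ≤ ‖h‖⁻¹ * (4 * M * (‖h • v‖ / r) ^ 2) := by gcongr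
    _ = C * ‖h‖ := by rw [norm_smul]; field_simp; simp only [C]; field_simp
    _ < ε := hhε

theorem differentiableOn_fderiv_apply [CompleteSpace F] {f : E → F} {U : Set E}
    (hf : DifferentiableOn ℂ f U) (hU : IsOpen U) (v : E) :
    DifferentiableOn ℂ (fun x => fderiv ℂ f x v) U := by
  intro x hx
  obtain ⟨r, hr, hrU, hfr⟩ : ∃ r > 0, ball x (r + r) ⊆ U ∧
      ∀ y ∈ ball x (r + r), ‖f y‖ ≤ ‖f x‖ + 1 := by
    have hcont : ∀ᶠ y in 𝓝 x, ‖f y‖ < ‖f x‖ + 1 :=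
      (hf.continuousOn.continuousAt (hU.mem_nhds hx)).norm.eventually_lt_const (lt_add_one _)
    obtain ⟨r, hr, hrs⟩ := Metric.mem_nhds_iff.1 (inter_mem (hU.mem_nhds hx) hcont)
    refine ⟨r / 2, half_pos hr, ?_⟩
    rw [add_halves]
    exact ⟨fun y hy => (hrs hy).1, fun y hy => (hrs hy).2.le⟩
  have hsub : ∀ y ∈ ball x r, ball y r ⊆ ball x (r + r) := fun y hy =>
    ball_subset_ball' (by rw [mem_ball] at hy; linarith)
  have hin : ∀ᶠ h : ℂ in 𝓝[≠] 0, ‖h • v‖ < r :=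
    tendsto_nhdsWithin_of_tendsto_nhds ((by fun_prop : Continuous _).tendsto' 0 0 (by simp))
      |>.eventually_lt_const hr
  have hquot : ∀ᶠ h : ℂ in 𝓝[≠] 0,
      DifferentiableOn ℂ (fun y => h⁻¹ • (f (y + h • v) - f y)) (ball x r) := by
    filter_upwards [hin] with h hh
    refine ((hf.comp (by fun_prop) fun y hy => ?_).sub (hf.mono fun y hy => ?_)).const_smul _
    · exact hrU (hsub y hy (by simpa using hh))
    · exact hrU (hsub y hy (mem_ball_self hr))
  exact (differentiableOn_of_tendstoUniformlyOn isOpen_ball hquot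
    (tendstoUniformlyOn_slope_fderiv hr (fun y hy => hf.mono ((hsub y hy).trans hrU))
      (fun y hy z hz => hfr z (hsub y hy hz)) v)).differentiableAt (ball_mem_nhds x hr)
    |>.differentiableWithinAt

theorem differentiableOn_iteratedDeriv_snd [CompleteSpace F] {U : Set (E × ℂ)} (hU : IsOpen U)
    {g : E × ℂ → F} (hg : DifferentiableOn ℂ g U) (k : ℕ) :
    DifferentiableOn ℂ (fun x => iteratedDeriv k (fun t => g (x.1, t)) x.2) U := by
  induction k with
  | zero => simpa only [iteratedDeriv_zero] using hg
  | succ k ih =>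
    refine (differentiableOn_fderiv_apply ih hU (0, 1)).congr fun x hx => ?_
    have hd : HasFDerivAt _ _ ((x.1, x.2) : E × ℂ) := ih.hasFDerivAt (hU.mem_nhds hx)
    rw [iteratedDeriv_succ]
    exact (hd.comp x.2 (hasFDerivAt_prodMk_right x.1 x.2)).hasDerivAt.deriv.trans (by simp)

theorem circleAverage_conj_pow_mul {φ : ℂ → ℂ} (hφ : DiffContOnCl ℂ φ (ball 0 1)) (k : ℕ) :
    Real.circleAverage (fun t => conj t ^ k * φ t) 0 1 =
      (k.factorial : ℂ)⁻¹ * iteratedDeriv k φ 0 := by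
  have hconj : (∮ z in C(0, 1), (z - 0)⁻¹ • (conj z ^ k * φ z)) =
      ∮ z in C(0, 1), (1 / (z - 0) ^ (k + 1)) • φ z := by
    refine circleIntegral.integral_congr zero_le_one fun z hz => ?_
    have hz1 : ‖z‖ = 1 := by simpa using hz
    simp only [sub_zero, smul_eq_mul, ← Complex.inv_eq_conj hz1, pow_succ, one_div, inv_pow,
      mul_inv]
    ring
  rw [Real.circleAverage_eq_circleIntegral one_ne_zero, hconj,
    hφ.circleIntegral_one_div_sub_center_pow_smul one_pos k]
  simp only [smul_eq_mul]
  field_simp [Complex.two_pi_I_ne_zero]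

end ComplexAnalysis

section PowerSeries

open Metric

variable {a : ℕ → ℂ} {ρ : ℝ}

theorem summable_norm_mul_pow_of_summable_choose_mul {m : ℕ} {t : ℝ} (ht : 0 ≤ t)
    (h : Summable fun k => ((k + m).choose m : ℂ) * a (k + m) * (t : ℂ) ^ k) :
    Summable fun k => ‖a k‖ * t ^ k := by
  rw [← summable_nat_add_iff m]
  refine (h.norm.mul_left (t ^ m)).of_nonneg_of_le (fun k => by positivity) fun k => ?_
  have hchoose : (1 : ℝ) ≤ (k + m).choose m :=
    mod_cast Nat.choose_pos (Nat.le_add_left m k)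
  rw [norm_mul, norm_mul, Complex.norm_natCast, norm_pow, Complex.norm_real,
    Real.norm_of_nonneg ht]
  calc ‖a (k + m)‖ * t ^ (k + m) = t ^ m * (1 * ‖a (k + m)‖ * t ^ k) := by ring
    _ ≤ _ := by gcongr

theorem summable_norm_succ_mul_mul_pow (ha : ∀ t, 0 ≤ t → t < ρ → Summable fun k => ‖a k‖ * t ^ k)
    {t : ℝ} (ht0 : 0 ≤ t) (ht : t < ρ) :
    Summable fun k : ℕ => ‖((k : ℂ) + 1) * a (k + 1)‖ * t ^ k := by
  obtain ⟨s, hts, hs⟩ := exists_between ht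
  have hs0 : 0 < s := ht0.trans_lt hts
  obtain ⟨M, hM⟩ := (ha s hs0.le hs).tendsto_atTop_zero.bddAbove_range
  have hq : ‖t / s‖ < 1 := by
    rwa [Real.norm_of_nonneg (by positivity), div_lt_one hs0]
  have hgeom := ((summable_pow_mul_geometric_of_norm_lt_one 1 hq).add
    (summable_geometric_of_norm_lt_one hq)).mul_left (M / s)
  refine hgeom.of_nonneg_of_le (fun k => by positivity) fun k => ?_
  have ha_le : ‖a (k + 1)‖ ≤ M / s ^ (k + 1) :=
    (le_div_iff₀ (by positivity)).2 (hM ⟨k + 1, rfl⟩)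
  have hk : ‖(k : ℂ) + 1‖ = k + 1 := by
    rw [← Nat.cast_succ, Complex.norm_natCast, Nat.cast_succ]
  rw [norm_mul, hk]
  calc (k + 1 : ℝ) * ‖a (k + 1)‖ * t ^ k ≤ (k + 1 : ℝ) * (M / s ^ (k + 1)) * t ^ k := by gcongr
    _ = _ := by rw [div_pow, pow_succ, pow_one]; field_simp

theorem hasDerivAt_tsum_mul_pow (ha : ∀ t, 0 ≤ t → t < ρ → Summable fun k => ‖a k‖ * t ^ k)
    {r : ℂ} (hr : ‖r‖ < ρ) :
    HasDerivAt (fun s => ∑' k, a k * s ^ k) (∑' k : ℕ, ((k : ℂ) + 1) * a (k + 1) * r ^ k) r := by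
  obtain ⟨t, hrt, ht⟩ := exists_between hr
  have ht0 : 0 < t := (norm_nonneg r).trans_lt hrt
  have hu : Summable fun k : ℕ => ‖(k : ℂ) * a k‖ * t ^ (k - 1) := by
    rw [← summable_nat_add_iff 1]
    simpa using summable_norm_succ_mul_mul_pow ha ht0.le ht
  have hle : ∀ (k : ℕ) (s : ℂ), ‖s‖ ≤ t →
      ‖a k * (k * s ^ (k - 1))‖ ≤ ‖(k : ℂ) * a k‖ * t ^ (k - 1) := fun k s hs => by
    rw [← mul_assoc, mul_comm (a k), norm_mul, norm_pow]
    gcongr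
  have h := hasDerivAt_tsum_of_isPreconnected (g := fun k s => a k * s ^ k)
    (g' := fun k s => a k * (k * s ^ (k - 1))) (y₀ := 0) hu isOpen_ball
    (convex_ball (0 : ℂ) t).isPreconnected
    (fun k s _ => (hasDerivAt_pow k s).const_mul (a k))
    (fun k s hs => hle k s (mem_ball_zero_iff.1 hs).le) (mem_ball_self ht0)
    ((hasSum_single 0 fun k hk => by simp [hk]).summable) (by simpa using hrt)
  refine h.congr_deriv ?_
  rw [(hu.of_norm_bounded fun k => hle k r hrt.le).tsum_eq_zero_add]
  simp only [Nat.cast_zero, zero_mul, mul_zero, zero_add, Nat.cast_succ, Nat.add_sub_cancel]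
  exact tsum_congr fun k => by ring

theorem analyticAt_tsum_mul_pow (ha : ∀ t, 0 ≤ t → t < ρ → Summable fun k => ‖a k‖ * t ^ k)
    {r : ℂ} (hr : ‖r‖ < ρ) : AnalyticAt ℂ (fun s => ∑' k, a k * s ^ k) r :=
  DifferentiableOn.analyticAt (s := ball 0 ρ)
    (fun _ hs => (hasDerivAt_tsum_mul_pow ha
      (mem_ball_zero_iff.1 hs)).differentiableAt.differentiableWithinAt)
    (isOpen_ball.mem_nhds (mem_ball_zero_iff.2 hr))

theorem eventually_summable_mul_pow (ha : ∀ t, 0 ≤ t → t < ρ → Summable fun k => ‖a k‖ * t ^ k)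
    {r : ℂ} (hr : ‖r‖ < ρ) : ∀ᶠ s in 𝓝 r, Summable fun k => a k * s ^ k := by
  filter_upwards [isOpen_ball.mem_nhds (mem_ball_zero_iff.2 hr)] with s hs
  refine .of_norm ?_
  simpa only [norm_mul, norm_pow] using ha ‖s‖ (norm_nonneg s) (mem_ball_zero_iff.1 hs)

theorem iteratedDeriv_tsum_mul_pow (m : ℕ)
    (ha : ∀ t, 0 ≤ t → t < ρ → Summable fun k => ‖a k‖ * t ^ k) {r : ℂ} (hr : ‖r‖ < ρ) :
    iteratedDeriv m (fun s => ∑' k, a k * s ^ k) r =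
      m.factorial * ∑' k, ((k + m).choose m : ℂ) * a (k + m) * r ^ k := by
  induction m generalizing a r with
  | zero => simp
  | succ m ih =>
    have hderiv : deriv (fun s => ∑' k, a k * s ^ k) =ᶠ[𝓝 r]
        fun s => ∑' k : ℕ, ((k : ℂ) + 1) * a (k + 1) * s ^ k := by
      filter_upwards [isOpen_ball.mem_nhds (mem_ball_zero_iff.2 hr)] with s hs
      exact (hasDerivAt_tsum_mul_pow ha (mem_ball_zero_iff.1 hs)).deriv
    rw [iteratedDeriv_succ', hderiv.iteratedDeriv_eq,
      ih (fun t ht0 ht => summable_norm_succ_mul_mul_pow ha ht0 ht) hr, ← tsum_mul_left,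
      ← tsum_mul_left]
    refine tsum_congr fun k => ?_
    have hchoose : ((k + m + 1 : ℕ) : ℂ) * (k + m).choose m =
        (k + m + 1).choose (m + 1) * (m + 1 : ℕ) :=
      mod_cast Nat.add_one_mul_choose_eq (k + m) m
    rw [Nat.factorial_succ, ← add_assoc k m 1]
    push_cast at hchoose ⊢
    linear_combination (m.factorial * a (k + m + 1) * r ^ k) * hchoose

end PowerSeries

theorem iteratedDeriv_comp_ofReal {f : ℂ → ℂ} {r : ℝ} (hf : AnalyticAt ℂ f r) (m : ℕ) :
    iteratedDeriv m (fun s : ℝ => f s) r = iteratedDeriv m f r := by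
  induction m generalizing f with
  | zero => simp
  | succ m ih =>
    have hderiv : deriv (fun s : ℝ => f s) =ᶠ[𝓝 r] fun s => deriv f s :=
      (Complex.continuous_ofReal.tendsto r).eventually hf.eventually_analyticAt |>.mono
        fun s hs => hs.differentiableAt.hasDerivAt.comp_ofReal.deriv
    rw [iteratedDeriv_succ', hderiv.iteratedDeriv_eq, ih hf.deriv, iteratedDeriv_succ']

section CircleInvariance

open Metric

variable {E F : Type*} [NormedAddCommGroup E] [NormedSpace ℂ E]

theorem circle_smul_preimage_ball (a : Circle) (r : ℝ) :
    (fun x : E => a • x) ⁻¹' ball 0 r = ball 0 r := by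
  ext x
  simp only [Set.mem_preimage, mem_ball_zero_iff, Circle.smul_def, norm_smul, Circle.norm_coe,
    one_mul]

variable [MeasurableSpace E] [BorelSpace E]

instance smulInvariantMeasure_restrict_ball {ρ : Measure E} [SMulInvariantMeasure Circle E ρ]
    (r : ℝ) : SMulInvariantMeasure Circle E (ρ.restrict (ball 0 r)) := by
  refine ⟨fun a s hs => ?_⟩
  have := ((measurePreserving_smul a ρ).restrict_preimage
    (measurableSet_ball (x := (0 : E)) (ε := r))).measure_preimage hs.nullMeasurableSet
  rwa [circle_smul_preimage_ball] at this

instance smulInvariantMeasure_of_isAddHaarMeasure [FiniteDimensional ℂ E]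
    (μ : Measure E) [μ.IsAddHaarMeasure] : SMulInvariantMeasure Circle E μ := by
  refine ⟨fun a s _ => ?_⟩
  have : FiniteDimensional ℝ E := FiniteDimensional.complexToReal E
  have : ProperSpace E := FiniteDimensional.proper ℂ E
  set L : E ≃ₗ[ℝ] E := (DistribMulAction.toLinearEquiv ℝ E a)
  have hdet := μ.addHaar_preimage_linearMap (f := L.toLinearMap) L.isUnit_det'.ne_zero
  have hball : (L.toLinearMap : E → E) ⁻¹' ball 0 1 = ball 0 1 := circle_smul_preimage_ball a 1
  have h1 : ENNReal.ofReal |(LinearMap.det L.toLinearMap)⁻¹| = 1 := by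
    have := hdet (ball 0 1)
    rw [hball] at this
    exact (ENNReal.mul_eq_right (measure_ball_pos μ 0 one_pos).ne' measure_ball_lt_top.ne).1
      this.symm
  have := hdet s
  rwa [h1, one_mul] at this

variable [SecondCountableTopology E] [NormedAddCommGroup F] [NormedSpace ℂ F] [CompleteSpace F]

theorem integral_circleAverage_smul {ρ : Measure E} [SFinite ρ] [SMulInvariantMeasure Circle E ρ]
    {f : E → F} (hf : Integrable f ρ) :
    ∫ x, Real.circleAverage (fun t => f (t • x)) 0 1 ∂ρ = ∫ x, f x ∂ρ := by
  set τ : Measure ℝ := volume.restrict (Set.Ioc 0 (2 * Real.pi))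
  have hexp : ∀ (θ : ℝ) (x : E), circleMap 0 1 θ • x = Circle.exp θ • x := fun θ x => by
    simp [Circle.smul_def, circleMap]
  have hcont : Continuous (Function.uncurry fun (θ : ℝ) (x : E) => Circle.exp θ • x) := by
    simp only [Function.uncurry_def]
    fun_prop
  have hmp : MeasurePreserving (fun p : ℝ × E => (p.1, Circle.exp p.1 • p.2))
      (τ.prod ρ) (τ.prod ρ) :=
    (MeasurePreserving.id τ).skew_product (g := fun (θ : ℝ) (x : E) => Circle.exp θ • x)
      hcont.measurable (.of_forall fun θ => (measurePreserving_smul _ ρ).map_eq)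
  have hswap := integral_integral_swap (f := fun (θ : ℝ) (x : E) => f (Circle.exp θ • x))
    (hmp.integrable_comp_of_integrable (hf.comp_snd τ))
  simp only [integral_smul_eq_self] at hswap
  simp only [Real.circleAverage_def, intervalIntegral.integral_of_le Real.two_pi_pos.le, hexp]
  rw [integral_smul, ← hswap, integral_const, measureReal_restrict_apply_univ,
    Real.volume_real_Ioc_of_le Real.two_pi_pos.le, sub_zero, inv_smul_smul₀ Real.two_pi_pos.ne']

theorem integral_eq_of_diffContOnCl_smul {ρ : Measure E} [SFinite ρ]
    [SMulInvariantMeasure Circle E ρ] {f : E → F} (hf : Integrable f ρ)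
    (hd : ∀ᵐ x ∂ρ, DiffContOnCl ℂ (fun t : ℂ => f (t • x)) (ball 0 1)) :
    ∫ x, f x ∂ρ = ρ.real Set.univ • f 0 := by
  rw [← integral_circleAverage_smul hf, ← integral_const]
  refine integral_congr_ae ?_
  filter_upwards [hd] with x hx
  rw [DiffContOnCl.circleAverage (by simpa using hx), zero_smul]

theorem norm_sq_mul_measureReal_ball_le [FiniteDimensional ℂ E] (μ : Measure E)
    [μ.IsAddHaarMeasure] {f : E → ℂ} {y : E} {r : ℝ}
    (hf : DifferentiableOn ℂ f (closedBall y r)) :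
    ‖f y‖ ^ 2 * μ.real (ball y r) ≤ ∫ x in ball y r, ‖f x‖ ^ 2 ∂μ := by
  have : ProperSpace E := FiniteDimensional.proper ℂ E
  have hd : DifferentiableOn ℂ (fun x => f (y + x) ^ 2) (closedBall 0 r) :=
    (hf.comp (by fun_prop) fun x hx => by simpa using hx).pow 2
  have hint : IntegrableOn (fun x => f (y + x) ^ 2) (ball 0 r) μ :=
    (hd.continuousOn.integrableOn_compact (isCompact_closedBall 0 r)).mono_set
      ball_subset_closedBall
  have hmean := integral_eq_of_diffContOnCl_smul hint (by
    filter_upwards [ae_restrict_mem measurableSet_ball] with x hx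
    refine (hd.comp (by fun_prop) fun t ht => ?_).diffContOnCl
    rw [closure_ball _ one_ne_zero, mem_closedBall_zero_iff] at ht
    rw [mem_ball_zero_iff] at hx
    rw [mem_closedBall_zero_iff, norm_smul]
    exact (mul_le_of_le_one_left (norm_nonneg x) ht).trans hx.le)
  simp only [add_zero, measureReal_restrict_apply_univ] at hmean
  have htranslate : ∫ x in ball 0 r, ‖f (y + x) ^ 2‖ ∂μ = ∫ x in ball y r, ‖f x‖ ^ 2 ∂μ := by
    simpa only [norm_pow, preimage_add_ball, sub_self] using
      (measurePreserving_add_left μ y).setIntegral_preimage_emb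
        (measurableEmbedding_addLeft y) (fun x => ‖f x‖ ^ 2) (ball y r)
  calc ‖f y‖ ^ 2 * μ.real (ball y r)
      = ‖μ.real (ball (0 : E) r) • f y ^ 2‖ := by
        rw [norm_smul, norm_pow, Real.norm_of_nonneg measureReal_nonneg, measureReal_def,
          measureReal_def, μ.addHaar_ball_center y, mul_comm]
    _ = ‖∫ x in ball 0 r, f (y + x) ^ 2 ∂μ‖ := by rw [hmean]
    _ ≤ ∫ x in ball 0 r, ‖f (y + x) ^ 2‖ ∂μ := norm_integral_le_integral_norm _
    _ = ∫ x in ball y r, ‖f x‖ ^ 2 ∂μ := htranslate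

end CircleInvariance

section BergmanSpace

open Metric Filter

theorem exists_inner_map_eq_of_isClosed_range {𝕜 M H : Type*} [RCLike 𝕜] [AddCommGroup M]
    [Module 𝕜 M] [NormedAddCommGroup H] [InnerProductSpace 𝕜 H] [CompleteSpace H]
    (T : M →ₗ[𝕜] H) (hT : IsClosed (T.range : Set H)) (φ : M →ₗ[𝕜] 𝕜) {C : ℝ}
    (hφ : ∀ f, ‖φ f‖ ≤ C * ‖T f‖) : ∃ k : M, ∀ f, inner 𝕜 (T k) (T f) = φ f := by
  have : CompleteSpace T.range := hT.completeSpace_coe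
  obtain ⟨S, hS⟩ := T.rangeRestrict.exists_rightInverse_of_surjective T.range_rangeRestrict
  have hTS : ∀ v : T.range, T (S v) = v := fun v => congrArg Subtype.val (LinearMap.congr_fun hS v)
  have hφS : ∀ f, φ (S (T.rangeRestrict f)) = φ f := fun f => by
    refine sub_eq_zero.1 (norm_le_zero_iff.1 ?_)
    simpa [hTS] using hφ (S (T.rangeRestrict f) - f)
  set ψ : T.range →L[𝕜] 𝕜 := (φ ∘ₗ S).mkContinuous C fun v => by simpa [hTS] using hφ (S v)
  refine ⟨S ((InnerProductSpace.toDual 𝕜 T.range).symm ψ), fun f => ?_⟩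
  calc _ = inner 𝕜 ((InnerProductSpace.toDual 𝕜 T.range).symm ψ) (T.rangeRestrict f) := by
        rw [hTS]; rfl
    _ = φ (S (T.rangeRestrict f)) := InnerProductSpace.toDual_symm_apply
    _ = φ f := hφS f

variable {E : Type*} [NormedAddCommGroup E] [NormedSpace ℂ E] [MeasurableSpace E]
  {μ : Measure E} {D : Set E} {q : E → ℝ}

theorem conj_kernel_eq_of_isBergmanKernel {K : E → E → ℂ} (hK : IsBergmanKernel μ D q K) {x y : E}
    (hx : x ∈ D) (hy : y ∈ D) : conj (K x y) = K y x := by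
  rw [(hK y hy).2 _ (hK x hx).1, (hK x hx).2 _ (hK y hy).1, ← integral_conj]
  refine integral_congr_ae (.of_forall fun z => ?_)
  simp only [map_mul, Complex.conj_conj, Complex.conj_ofReal]
  ring

/-- The weighted Bergman space `H(D, q)` as a space of functions. Integrability is encoded as
square-integrability of `f √q`, which makes closure under addition immediate; functions that agree
on `D` are not identified. -/
def bergmanSpace (μ : Measure E) (D : Set E) (q : E → ℝ) : Submodule ℂ (E → ℂ) where
  carrier := {f | DifferentiableOn ℂ f D ∧ MemLp (fun x => f x * (√(q x) : ℂ)) 2 (μ.restrict D)}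
  zero_mem' := ⟨differentiableOn_const 0, by simp⟩
  add_mem' hf hg := ⟨hf.1.add hg.1,
    (hf.2.add hg.2).ae_eq (.of_forall fun _ => (add_mul _ _ _).symm)⟩
  smul_mem' c _ hf := ⟨hf.1.const_smul c,
    (hf.2.const_smul c).ae_eq (.of_forall fun _ => (mul_assoc _ _ _).symm)⟩

/-- The map `f ↦ f √q` from the weighted Bergman space `H(D, q)` to the unweighted `L²(D)`. -/
noncomputable def bergmanToLp (μ : Measure E) (D : Set E) (q : E → ℝ) :
    bergmanSpace μ D q →ₗ[ℂ] Lp ℂ 2 (μ.restrict D) where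
  toFun f := f.2.2.toLp _
  map_add' f g := by
    rw [← MemLp.toLp_add]
    exact MemLp.toLp_congr _ _ (.of_forall fun x => add_mul _ _ _)
  map_smul' c f := by
    rw [RingHom.id_apply, ← MemLp.toLp_const_smul]
    exact MemLp.toLp_congr _ _ (.of_forall fun x => mul_assoc _ _ _)

theorem coeFn_bergmanToLp (f : bergmanSpace μ D q) :
    bergmanToLp μ D q f =ᵐ[μ.restrict D] fun x => f.1 x * (√(q x) : ℂ) :=
  f.2.2.coeFn_toLp

theorem inner_bergmanToLp (hD : MeasurableSet D) (hq0 : ∀ x ∈ D, 0 ≤ q x)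
    (f g : bergmanSpace μ D q) :
    inner ℂ (bergmanToLp μ D q f) (bergmanToLp μ D q g) =
      ∫ x in D, g.1 x * conj (f.1 x) * (q x : ℂ) ∂μ := by
  rw [L2.inner_def]
  refine integral_congr_ae ?_
  filter_upwards [coeFn_bergmanToLp f, coeFn_bergmanToLp g, ae_restrict_mem hD] with x hf hg hx
  rw [hf, hg, RCLike.inner_apply, map_mul, Complex.conj_ofReal,
    ← Complex.ofReal_inj.2 (Real.mul_self_sqrt (hq0 x hx)), Complex.ofReal_mul]
  ring

theorem norm_bergmanToLp_sq (hD : MeasurableSet D) (hq0 : ∀ x ∈ D, 0 ≤ q x)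
    (f : bergmanSpace μ D q) :
    ‖bergmanToLp μ D q f‖ ^ 2 = ∫ x in D, ‖f.1 x‖ ^ 2 * q x ∂μ := by
  have h := inner_bergmanToLp hD hq0 f f
  simp only [inner_self_eq_norm_sq_to_K, Complex.mul_conj'] at h
  norm_cast at h
  exact Complex.ofReal_injective h

variable [FiniteDimensional ℂ E] [BorelSpace E]

theorem mem_bergmanSpace_iff (hD : IsOpen D) (hq : ContinuousOn q D) (hq0 : ∀ x ∈ D, 0 ≤ q x)
    {f : E → ℂ} : f ∈ bergmanSpace μ D q ↔ MemBergman μ D q f := by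
  refine and_congr_right fun hf => ?_
  have : ProperSpace E := FiniteDimensional.proper ℂ E
  have hmeas : AEStronglyMeasurable (fun x => f x * (√(q x) : ℂ)) (μ.restrict D) :=
    (hf.continuousOn.mul (Complex.continuous_ofReal.comp_continuousOn
      hq.sqrt)).aestronglyMeasurable hD.measurableSet
  rw [memLp_two_iff_integrable_sq_norm hmeas]
  refine integrableOn_congr_fun (fun x hx => ?_) hD.measurableSet
  simp [mul_pow, Complex.norm_real, Real.sq_sqrt (hq0 x hx)]

variable [μ.IsAddHaarMeasure]

theorem norm_sq_mul_le_norm_bergmanToLp_sq (hD : IsOpen D) (hq : ContinuousOn q D)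
    (hq0 : ∀ x ∈ D, 0 ≤ q x) {y : E} {r c : ℝ} (hy : closedBall y r ⊆ D)
    (hc : ∀ x ∈ ball y r, c ≤ q x) (hc0 : 0 ≤ c) (f : bergmanSpace μ D q) :
    ‖f.1 y‖ ^ 2 * (c * μ.real (ball y r)) ≤ ‖bergmanToLp μ D q f‖ ^ 2 := by
  have : ProperSpace E := FiniteDimensional.proper ℂ E
  have hf := (mem_bergmanSpace_iff hD hq hq0).1 f.2
  have hyD : ball y r ⊆ D := ball_subset_closedBall.trans hy
  have hint : IntegrableOn (fun x => ‖f.1 x‖ ^ 2) (ball y r) μ :=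
    ((hf.1.continuousOn.mono hy).norm.pow 2).integrableOn_compact
      (isCompact_closedBall y r) |>.mono_set ball_subset_closedBall
  calc ‖f.1 y‖ ^ 2 * (c * μ.real (ball y r)) = c * (‖f.1 y‖ ^ 2 * μ.real (ball y r)) := by ring
    _ ≤ c * ∫ x in ball y r, ‖f.1 x‖ ^ 2 ∂μ := by
        gcongr
        exact norm_sq_mul_measureReal_ball_le μ (hf.1.mono hy)
    _ = ∫ x in ball y r, ‖f.1 x‖ ^ 2 * c ∂μ := by rw [integral_mul_const, mul_comm]
    _ ≤ ∫ x in ball y r, ‖f.1 x‖ ^ 2 * q x ∂μ :=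
        setIntegral_mono_on (hint.mul_const _) (hf.2.mono_set hyD) measurableSet_ball
          fun x hx => mul_le_mul_of_nonneg_left (hc x hx) (by positivity)
    _ ≤ ∫ x in D, ‖f.1 x‖ ^ 2 * q x ∂μ := by
        refine setIntegral_mono_set hf.2 ?_ hyD.eventuallyLE
        filter_upwards [ae_restrict_mem hD.measurableSet] with x hx
        exact mul_nonneg (by positivity) (hq0 x hx)
    _ = ‖bergmanToLp μ D q f‖ ^ 2 := (norm_bergmanToLp_sq hD.measurableSet hq0 f).symm

theorem exists_ball_norm_le_norm_bergmanToLp (hD : IsOpen D) (hq : ContinuousOn q D)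
    (hq0 : ∀ x ∈ D, 0 < q x) {x : E} (hx : x ∈ D) :
    ∃ r > 0, ball x r ⊆ D ∧ ∃ C > 0, ∀ f : bergmanSpace μ D q, ∀ y ∈ ball x r,
      ‖f.1 y‖ ≤ C * ‖bergmanToLp μ D q f‖ := by
  have hev : ∀ᶠ y in 𝓝 x, q x / 2 < q y ∧ y ∈ D :=
    ((hq.continuousAt (hD.mem_nhds hx)).eventually (lt_mem_nhds (half_lt_self (hq0 x hx)))).and
      (hD.mem_nhds hx)
  obtain ⟨R, hR, hRq⟩ := Metric.eventually_nhds_iff_ball.1 hev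
  set r := R / 2
  have hr : 0 < r := half_pos hR
  have : ProperSpace E := FiniteDimensional.proper ℂ E
  set c : ℝ := q x / 2 * μ.real (ball 0 (r / 2))
  have hc : 0 < c := mul_pos (half_pos (hq0 x hx))
    (ENNReal.toReal_pos (measure_ball_pos μ 0 (half_pos hr)).ne' measure_ball_lt_top.ne)
  refine ⟨r, hr, fun y hy => (hRq y (ball_subset_ball (half_le_self hR.le) hy)).2, (√c)⁻¹,
    by positivity, fun f y hy => ?_⟩
  have hsub : closedBall y (r / 2) ⊆ ball x R := closedBall_subset_ball' (by
    rw [mem_ball] at hy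
    simp only [r] at hy ⊢
    linarith)
  have h := norm_sq_mul_le_norm_bergmanToLp_sq hD hq (fun x hx => (hq0 x hx).le)
    (fun z hz => (hRq z (hsub hz)).2) (fun z hz => (hRq z (hsub (ball_subset_closedBall hz))).1.le)
    (half_pos (hq0 x hx)).le f
  rw [measureReal_def, μ.addHaar_ball_center, ← measureReal_def] at h
  rw [inv_mul_eq_div, le_div_iff₀ (by positivity)]
  refine le_of_sq_le_sq ?_ (norm_nonneg _)
  rwa [mul_pow, Real.sq_sqrt hc.le]

theorem isClosed_range_bergmanToLp (hD : IsOpen D) (hq : ContinuousOn q D)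
    (hq0 : ∀ x ∈ D, 0 < q x) :
    IsClosed ((bergmanToLp μ D q).range : Set (Lp ℂ 2 (μ.restrict D))) := by
  refine IsSeqClosed.isClosed fun F G hF hG => ?_
  choose f hf using hF
  have hcauchy : ∀ x ∈ D, ∃ r > 0, ball x r ⊆ D ∧
      UniformCauchySeqOn (fun n => (f n).1) atTop (ball x r) := fun x hx => by
    obtain ⟨r, hr, hrD, C, hC, hle⟩ := exists_ball_norm_le_norm_bergmanToLp (μ := μ) hD hq hq0 hx
    refine ⟨r, hr, hrD, Metric.uniformCauchySeqOn_iff.2 fun ε hε => ?_⟩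
    obtain ⟨N, hN⟩ := Metric.cauchySeq_iff.1 hG.cauchySeq (ε / C) (by positivity)
    refine ⟨N, fun i hi j hj y hy => ?_⟩
    have h := hle (f i - f j) y hy
    rw [map_sub, hf, hf, ← dist_eq_norm] at h
    rw [dist_eq_norm]
    exact h.trans_lt ((lt_div_iff₀' hC).1 (hN i hi j hj))
  have hlim : ∀ x ∈ D, ∃ l, Tendsto (fun n => (f n).1 x) atTop (𝓝 l) := fun x hx => by
    obtain ⟨r, hr, -, hC⟩ := hcauchy x hx
    exact cauchySeq_tendsto_of_complete (hC.cauchySeq (mem_ball_self hr))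
  choose! g hg using hlim
  have hgd : DifferentiableOn ℂ g D := fun x hx => by
    obtain ⟨r, hr, hrD, hC⟩ := hcauchy x hx
    exact (differentiableOn_of_tendstoUniformlyOn isOpen_ball
      (.of_forall fun n => (f n).2.1.mono hrD) (hC.tendstoUniformlyOn_of_tendsto
        fun y hy => hg y (hrD hy))).differentiableAt (ball_mem_nhds x hr) |>.differentiableWithinAt
  have hgG : G =ᵐ[μ.restrict D] fun x => g x * (√(q x) : ℂ) := by
    obtain ⟨ns, hns, hae⟩ := (tendstoInMeasure_of_tendsto_Lp hG).exists_seq_tendsto_ae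
    have hfF := fun n => coeFn_bergmanToLp (f n)
    simp only [hf] at hfF
    filter_upwards [hae, ae_all_iff.2 hfF, ae_restrict_mem hD.measurableSet] with x hGx hFx hx
    refine tendsto_nhds_unique hGx ?_
    simp only [hFx]
    exact ((hg x hx).comp hns.tendsto_atTop).mul_const _
  refine ⟨⟨g, hgd, (Lp.memLp G).ae_eq hgG⟩, Lp.ext ?_⟩
  exact (coeFn_bergmanToLp _).trans hgG.symm

theorem exists_isBergmanKernel (hD : IsOpen D) (hq : ContinuousOn q D) (hq0 : ∀ x ∈ D, 0 < q x) :
    ∃ K : E → E → ℂ, IsBergmanKernel μ D q K := by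
  have hq0' : ∀ x ∈ D, 0 ≤ q x := fun x hx => (hq0 x hx).le
  have hriesz : ∀ y ∈ D, ∃ k : bergmanSpace μ D q, ∀ f,
      inner ℂ (bergmanToLp μ D q k) (bergmanToLp μ D q f) = f.1 y := fun y hy => by
    obtain ⟨r, hr, -, C, -, hle⟩ := exists_ball_norm_le_norm_bergmanToLp (μ := μ) hD hq hq0 hy
    exact exists_inner_map_eq_of_isClosed_range _ (isClosed_range_bergmanToLp hD hq hq0)
      (LinearMap.proj y ∘ₗ (bergmanSpace μ D q).subtype) fun f => hle f y (mem_ball_self hr)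
  choose! k hk using hriesz
  refine ⟨fun x y => (k y).1 x, fun y hy =>
    ⟨(mem_bergmanSpace_iff hD hq hq0').1 (k y).2, fun f hf => ?_⟩⟩
  rw [← inner_bergmanToLp hD.measurableSet hq0' (k y)
    ⟨f, (mem_bergmanSpace_iff hD hq hq0').2 hf⟩, hk y hy]

theorem isBergmanKernel_bergmanKernel (hD : IsOpen D) (hq : ContinuousOn q D)
    (hq0 : ∀ x ∈ D, 0 < q x) : IsBergmanKernel μ D q (bergmanKernel μ D q) := by
  have h := exists_isBergmanKernel (μ := μ) hD hq hq0
  rw [bergmanKernel, dif_pos h]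
  exact h.choose_spec

end BergmanSpace

section Slices

open Filter

variable {α β F : Type*} [MeasurableSpace α] [MeasurableSpace β] [NormedAddCommGroup F]
  {μ : Measure α} {ν : Measure β} [SFinite ν] {D : Set (α × β)} {f : α × β → F}

theorem integrableOn_prod_iff_slice (hD : MeasurableSet D)
    (hf : AEStronglyMeasurable f ((μ.prod ν).restrict D)) :
    IntegrableOn f D (μ.prod ν) ↔
      (∀ᵐ a ∂μ, IntegrableOn (fun b => f (a, b)) (Prod.mk a ⁻¹' D) ν) ∧
        Integrable (fun a => ∫ b in Prod.mk a ⁻¹' D, ‖f (a, b)‖ ∂ν) μ := by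
  have hslice : ∀ a, MeasurableSet (Prod.mk a ⁻¹' D) := fun _ => measurable_prodMk_left hD
  rw [← integrable_indicator_iff hD,
    integrable_prod_iff ((aestronglyMeasurable_indicator_iff hD).2 hf)]
  refine and_congr (eventually_congr (.of_forall fun a => ?_))
    (integrable_congr (.of_forall fun a => ?_))
  · exact integrable_indicator_iff (f := fun b => f (a, b)) (hslice a)
  · simp only [norm_indicator_eq_indicator_norm]
    exact integral_indicator (f := fun b => ‖f (a, b)‖) (hslice a)

variable [SFinite μ] [NormedSpace ℝ F]

theorem setIntegral_prod_slice (hD : MeasurableSet D) (hf : IntegrableOn f D (μ.prod ν)) :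
    ∫ x in D, f x ∂(μ.prod ν) = ∫ a, ∫ b in Prod.mk a ⁻¹' D, f (a, b) ∂ν ∂μ := by
  rw [← integral_indicator hD, integral_prod _ ((integrable_indicator_iff hD).2 hf)]
  exact integral_congr_ae (.of_forall fun a =>
    integral_indicator (f := fun b => f (a, b)) (measurable_prodMk_left hD))

theorem setIntegral_prod_slice_symm (hD : MeasurableSet D) (hf : IntegrableOn f D (μ.prod ν)) :
    ∫ x in D, f x ∂(μ.prod ν) = ∫ b, ∫ a in (fun a => (a, b)) ⁻¹' D, f (a, b) ∂μ ∂ν := by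
  rw [← integral_indicator hD, integral_prod_symm _ ((integrable_indicator_iff hD).2 hf)]
  exact integral_congr_ae (.of_forall fun b =>
    integral_indicator (f := fun a => f (a, b)) (measurable_prodMk_right hD))

end Slices

section Homogeneous

open Metric Filter Module

variable {E F : Type*} [NormedAddCommGroup E] [NormedAddCommGroup F]

theorem exists_norm_le_mul_norm_pow_of_homogeneous {𝕜 : Type*} [RCLike 𝕜] [NormedSpace 𝕜 E]
    [NormedSpace 𝕜 F] [ProperSpace E] {φ : E → F} (hc : Continuous φ) {k : ℕ}
    (hφ : ∀ (c : 𝕜) x, φ (c • x) = c ^ k • φ x) : ∃ M, ∀ x, ‖φ x‖ ≤ M * ‖x‖ ^ k := by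
  obtain ⟨M, hM⟩ := (isCompact_closedBall (0 : E) 1).exists_bound_of_continuousOn hc.continuousOn
  refine ⟨M, fun x => ?_⟩
  set u : E := ((‖x‖⁻¹ : ℝ) : 𝕜) • x
  have hu : ‖u‖ ≤ 1 := by
    rw [norm_smul, RCLike.norm_ofReal, abs_of_nonneg (by positivity)]
    exact inv_mul_le_one
  have hx : x = ((‖x‖ : ℝ) : 𝕜) • u := by
    rcases eq_or_ne x 0 with rfl | h
    · simp
    · rw [smul_smul, ← RCLike.ofReal_mul, mul_inv_cancel₀ (norm_ne_zero_iff.2 h),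
        RCLike.ofReal_one, one_smul]
  calc ‖φ x‖ = ‖φ (((‖x‖ : ℝ) : 𝕜) • u)‖ := by rw [← hx]
    _ = ‖φ u‖ * ‖x‖ ^ k := by
      rw [hφ, norm_smul, norm_pow, RCLike.norm_ofReal, abs_norm, mul_comm]
    _ ≤ M * ‖x‖ ^ k := by
      gcongr
      exact hM u (by simpa using hu)

variable [NormedSpace ℝ E] [FiniteDimensional ℝ E] [MeasurableSpace E] [BorelSpace E]
  (μ : Measure E) [μ.IsAddHaarMeasure]

theorem setIntegral_ball_of_homogeneous [NormedSpace ℝ F] {φ : E → F} {k : ℕ}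
    (hφ : ∀ (c : ℝ) x, φ (c • x) = c ^ k • φ x) {r : ℝ} (hr : 0 < r) :
    ∫ x in ball 0 r, φ x ∂μ = r ^ (k + finrank ℝ E) • ∫ x in ball 0 1, φ x ∂μ := by
  have h := Measure.setIntegral_comp_smul_of_pos μ φ (ball 0 1) hr
  simp only [hφ, integral_smul] at h
  rw [smul_unitBall hr.ne', Real.norm_of_nonneg hr.le, eq_inv_smul_iff₀ (by positivity)] at h
  rw [← h, smul_smul, pow_add, mul_comm]

theorem integrable_norm_pow_mul_exp_sub_sq (k : ℕ) (a : ℝ) :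
    Integrable (fun x : E => ‖x‖ ^ k * Real.exp (a * ‖x‖ - ‖x‖ ^ 2)) μ := by
  set N := finrank ℝ E + 1
  have hint := integrable_one_add_norm (E := E) (μ := μ) (r := N) (by simp [N])
  refine (hint.const_mul (k.factorial * N.factorial * Real.exp (1 + (a + 2) ^ 2 / 4))).mono'
    (by fun_prop) (.of_forall fun x => ?_)
  set u := ‖x‖
  have hu : 0 ≤ u := norm_nonneg x
  have hpow : ∀ n : ℕ, ∀ t ≥ 0, t ^ n ≤ n.factorial * Real.exp t := fun n t ht =>
    (div_le_iff₀' (by positivity)).1 (Real.pow_div_factorial_le_exp t ht n)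
  rw [Real.norm_of_nonneg (by positivity), Real.rpow_neg (by positivity), Real.rpow_natCast,
    ← div_eq_mul_inv, le_div_iff₀ (by positivity)]
  calc u ^ k * Real.exp (a * u - u ^ 2) * (1 + u) ^ N
      ≤ (k.factorial * Real.exp u) * Real.exp (a * u - u ^ 2) *
        (N.factorial * Real.exp (1 + u)) := by
        gcongr
        exacts [hpow k u hu, hpow N (1 + u) (by positivity)]
    _ = k.factorial * N.factorial * Real.exp (u + (a * u - u ^ 2) + (1 + u)) := by
        rw [Real.exp_add (u + (a * u - u ^ 2)), Real.exp_add u]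
        ring
    _ ≤ k.factorial * N.factorial * Real.exp (1 + (a + 2) ^ 2 / 4) := by
        refine mul_le_mul_of_nonneg_left (Real.exp_le_exp.2 ?_) (by positivity)
        nlinarith [sq_nonneg (u - (a + 2) / 2)]

theorem integrable_mul_exp_of_homogeneous {𝕜 : Type*} [RCLike 𝕜] [NormedSpace 𝕜 E]
    [NormedSpace 𝕜 F] {φ : E → F} (hc : Continuous φ) {k : ℕ}
    (hφ : ∀ (c : 𝕜) x, φ (c • x) = c ^ k • φ x) (a : ℝ) :
    Integrable (fun x => ‖φ x‖ * Real.exp (a * ‖x‖ - ‖x‖ ^ 2)) μ := by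
  have : ProperSpace E := FiniteDimensional.proper ℝ E
  obtain ⟨M, hM⟩ := exists_norm_le_mul_norm_pow_of_homogeneous hc hφ
  refine ((integrable_norm_pow_mul_exp_sub_sq μ k a).const_mul M).mono'
    (by fun_prop) (.of_forall fun x => ?_)
  rw [Real.norm_of_nonneg (by positivity), ← mul_assoc]
  gcongr
  exact hM x

variable {μ} in
theorem integral_exp_neg_norm_sq_smul [NormedSpace ℝ F] [CompleteSpace F] {φ : E → F}
    (hφ : Integrable (fun x => Real.exp (-‖x‖ ^ 2) • φ x) μ) :
    ∫ x, Real.exp (-‖x‖ ^ 2) • φ x ∂μ =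
      ∫ s, Real.exp (-s) • ∫ x in ball 0 √s, φ x ∂μ := by
  set D : Set (E × ℝ) := {x | ‖x.1‖ ^ 2 < x.2}
  have hD : MeasurableSet D := measurableSet_lt (by fun_prop) (by fun_prop)
  have hslice : ∀ x : E, Prod.mk x ⁻¹' D = Set.Ioi (‖x‖ ^ 2) := fun x => rfl
  have hball : ∀ s : ℝ, (fun x => (x, s)) ⁻¹' D = ball (0 : E) √s := fun s => by
    ext x
    simp [D, Real.lt_sqrt]
  have hφm : AEStronglyMeasurable φ μ := by
    refine ((Continuous.aestronglyMeasurable (by fun_prop :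
      Continuous fun x : E => Real.exp (‖x‖ ^ 2))).smul hφ.1).congr (.of_forall fun x => ?_)
    simp [smul_smul, ← Real.exp_add]
  have hint : IntegrableOn (fun x => Real.exp (-x.2) • φ x.1) D (μ.prod volume) := by
    refine (integrableOn_prod_iff_slice hD ((Continuous.aestronglyMeasurable
      (by fun_prop)).smul hφm.comp_fst).restrict).2 ⟨.of_forall fun x => ?_, ?_⟩
    · rw [hslice]
      exact Integrable.smul_const (integrableOn_exp_neg_Ioi _) (φ x)
    · simpa only [hslice, Pi.smul_apply', norm_smul,
        Real.norm_of_nonneg (Real.exp_pos _).le, integral_mul_const, integral_exp_neg_Ioi]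
        using hφ.norm
  calc ∫ x, Real.exp (-‖x‖ ^ 2) • φ x ∂μ
      = ∫ x, ∫ s in Prod.mk x ⁻¹' D, Real.exp (-s) • φ x ∂volume ∂μ := by
        simp only [hslice, integral_smul_const, integral_exp_neg_Ioi]
    _ = ∫ s, ∫ x in (fun x => (x, s)) ⁻¹' D, Real.exp (-s) • φ x ∂μ := by
        rw [← setIntegral_prod_slice hD hint, setIntegral_prod_slice_symm hD hint]
    _ = ∫ s, Real.exp (-s) • ∫ x in ball 0 √s, φ x ∂μ := by
        simp only [hball, integral_smul]

theorem integral_exp_neg_norm_sq_smul_of_homogeneous [NormedSpace ℝ F] [CompleteSpace F]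
    {φ : E → F} (hc : Continuous φ) {k : ℕ} (hφ : ∀ (c : ℝ) x, φ (c • x) = c ^ k • φ x) :
    ∫ x, Real.exp (-‖x‖ ^ 2) • φ x ∂μ =
      Real.Gamma ((k + finrank ℝ E : ℕ) / 2 + 1) • ∫ x in ball 0 1, φ x ∂μ := by
  set n := k + finrank ℝ E
  set I := ∫ x in ball 0 1, φ x ∂μ
  have hint : Integrable (fun x => Real.exp (-‖x‖ ^ 2) • φ x) μ := by
    refine (integrable_mul_exp_of_homogeneous μ hc hφ 0).mono
      (by fun_prop) (.of_forall fun x => ?_)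
    simp [norm_smul, mul_comm]
  calc ∫ x, Real.exp (-‖x‖ ^ 2) • φ x ∂μ
      = ∫ s, Real.exp (-s) • ∫ x in ball 0 √s, φ x ∂μ := integral_exp_neg_norm_sq_smul hint
    _ = ∫ s in Set.Ioi 0, Real.exp (-s) • ∫ x in ball 0 √s, φ x ∂μ := by
        refine (setIntegral_eq_integral_of_forall_compl_eq_zero fun s hs => ?_).symm
        simp [Real.sqrt_eq_zero_of_nonpos (not_lt.1 hs)]
    _ = ∫ s in Set.Ioi 0, (Real.exp (-s) * s ^ ((n / 2 + 1 : ℝ) - 1)) • I := by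
        refine setIntegral_congr_fun measurableSet_Ioi fun s hs => ?_
        rw [setIntegral_ball_of_homogeneous μ hφ (Real.sqrt_pos.2 hs), smul_smul,
          add_sub_cancel_right, Real.rpow_div_two_eq_sqrt _ (le_of_lt hs), Real.rpow_natCast]
    _ = Real.Gamma (n / 2 + 1) • I := by
        rw [integral_smul_const, Real.Gamma_eq_integral (by positivity)]

end Homogeneous

section BargmannFock

open Metric Module

theorem integral_exp_neg_norm_sq_smul_of_differentiable {W F : Type*} [NormedAddCommGroup W]
    [NormedSpace ℂ W] [FiniteDimensional ℂ W] [MeasurableSpace W] [BorelSpace W]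
    (μ : Measure W) [μ.IsAddHaarMeasure] [NormedAddCommGroup F] [NormedSpace ℂ F] [CompleteSpace F]
    {G : W → F} (hG : Differentiable ℂ G)
    (hint : Integrable (fun Z => Real.exp (-‖Z‖ ^ 2) • G Z) μ) :
    ∫ Z, Real.exp (-‖Z‖ ^ 2) • G Z ∂μ = (∫ Z : W, Real.exp (-‖Z‖ ^ 2) ∂μ) • G 0 := by
  have : ProperSpace W := FiniteDimensional.proper ℂ W
  rw [← integral_circleAverage_smul hint, ← integral_smul_const]
  refine integral_congr_ae (.of_forall fun Z => ?_)
  have hl : Differentiable ℂ fun t : ℂ => G (t • Z) := hG.comp (by fun_prop)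
  have hsphere : ∀ t ∈ sphere (0 : ℂ) |1|, Real.exp (-‖t • Z‖ ^ 2) • G (t • Z) =
      Real.exp (-‖Z‖ ^ 2) • G (t • Z) := fun t ht => by
    rw [norm_smul, mem_sphere_zero_iff_norm.1 ht, abs_one, one_mul]
  beta_reduce
  rw [Real.circleAverage_congr_sphere hsphere, Real.circleAverage_fun_smul,
    DiffContOnCl.circleAverage hl.diffContOnCl, zero_smul]

theorem circleAverage_pow_mul_cexp_conj (k : ℕ) (a : ℂ) :
    Real.circleAverage (fun t => t ^ k * Complex.exp (conj t * a)) 0 1 =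
      (k.factorial : ℂ)⁻¹ * a ^ k := by
  have hd : Differentiable ℂ fun t : ℂ => Complex.exp (conj a * t) := by fun_prop
  calc Real.circleAverage (fun t => t ^ k * Complex.exp (conj t * a)) 0 1
      = Real.circleAverage (Complex.conjCLE.toContinuousLinearMap ∘
          fun t => conj t ^ k * Complex.exp (conj a * t)) 0 1 := by
        congr 1
        ext t
        simp [← Complex.exp_conj, mul_comm a]
    _ = conj (Real.circleAverage (fun t => conj t ^ k * Complex.exp (conj a * t)) 0 1) :=
        Complex.conjCLE.toContinuousLinearMap.circleAverage_comp_comm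
          (Continuous.continuousOn (by fun_prop)).circleIntegrable'
    _ = (k.factorial : ℂ)⁻¹ * a ^ k := by
        rw [circleAverage_conj_pow_mul hd.diffContOnCl k, iteratedDeriv_cexp_const_mul]
        simp

variable {W : Type*} [NormedAddCommGroup W] [InnerProductSpace ℂ W] [FiniteDimensional ℂ W]
  [MeasurableSpace W] [BorelSpace W] (μ : Measure W) [μ.IsAddHaarMeasure] {h : W → ℂ}

theorem integral_exp_neg_norm_sq_smul_cexp_inner_mul (hh : Differentiable ℂ h) (w : W)
    (hint : Integrable (fun Z => Real.exp (-‖Z‖ ^ 2) • (Complex.exp (inner ℂ Z w) * h Z)) μ) :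
    ∫ Z, Real.exp (-‖Z‖ ^ 2) • (Complex.exp (inner ℂ Z w) * h Z) ∂μ =
      (∫ Z : W, Real.exp (-‖Z‖ ^ 2) ∂μ) • h w := by
  have hshift : ∀ Z : W,
      Real.exp (-‖Z + w‖ ^ 2) • (Complex.exp (inner ℂ (Z + w) w) * h (Z + w)) =
        Real.exp (-‖Z‖ ^ 2) • (Complex.exp (-inner ℂ w Z) * h (Z + w)) := fun Z => by
    have hexp : -((‖Z + w‖ : ℂ) ^ 2) + inner ℂ (Z + w) w = -((‖Z‖ : ℂ) ^ 2) + -inner ℂ w Z := by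
      have hself : ∀ v : W, (‖v‖ : ℂ) ^ 2 = inner ℂ v v := fun v =>
        (inner_self_eq_norm_sq_to_K v).symm
      simp only [hself, inner_add_left, inner_add_right]
      ring
    simp only [Complex.real_smul, Complex.ofReal_exp, ← mul_assoc, ← Complex.exp_add]
    push_cast
    rw [hexp]
  have hG : Differentiable ℂ fun Z => Complex.exp (-inner ℂ w Z) * h (Z + w) :=
    (innerSL ℂ w).differentiable.neg.cexp.mul (hh.comp (differentiable_id.add_const w))
  have hint' := hint.comp_add_right w
  simp only [hshift] at hint'
  rw [← integral_add_right_eq_self _ w]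
  simp only [hshift, integral_exp_neg_norm_sq_smul_of_differentiable μ hG hint']
  simp

theorem integrable_exp_neg_norm_sq_smul_cexp_inner_mul (hh : Continuous h) {k : ℕ}
    (hk : ∀ (t : ℂ) Z, h (t • Z) = t ^ k * h Z) (w : W) :
    Integrable (fun Z => Real.exp (-‖Z‖ ^ 2) • (Complex.exp (inner ℂ Z w) * h Z)) μ := by
  have : ProperSpace W := FiniteDimensional.proper ℂ W
  have : FiniteDimensional ℝ W := FiniteDimensional.complexToReal W
  refine (integrable_mul_exp_of_homogeneous μ hh hk ‖w‖).mono
    (by fun_prop) (.of_forall fun Z => ?_)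
  rw [norm_smul, norm_mul, norm_mul, norm_norm, Complex.norm_exp,
    Real.norm_of_nonneg (by positivity), Real.norm_of_nonneg (by positivity), ← mul_assoc,
    ← Real.exp_add, mul_comm]
  gcongr
  have := re_inner_le_norm (𝕜 := ℂ) Z w
  rw [RCLike.re_eq_complex_re] at this
  linarith

theorem integral_exp_neg_norm_sq_smul_mul_inner_pow (hh : Differentiable ℂ h) {k : ℕ}
    (hk : ∀ (t : ℂ) Z, h (t • Z) = t ^ k * h Z) (w : W) :
    ∫ Z, Real.exp (-‖Z‖ ^ 2) • (h Z * inner ℂ Z w ^ k) ∂μ =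
      (k.factorial * ∫ Z : W, Real.exp (-‖Z‖ ^ 2) ∂μ) • h w := by
  have : ProperSpace W := FiniteDimensional.proper ℂ W
  have hint := integrable_exp_neg_norm_sq_smul_cexp_inner_mul μ hh.continuous hk w
  rw [mul_smul, ← integral_exp_neg_norm_sq_smul_cexp_inner_mul μ hh w hint,
    ← integral_circleAverage_smul hint, ← integral_smul]
  refine integral_congr_ae (.of_forall fun Z => ?_)
  have hsphere : ∀ t ∈ sphere (0 : ℂ) |1|,
      Real.exp (-‖t • Z‖ ^ 2) • (Complex.exp (inner ℂ (t • Z) w) * h (t • Z)) =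
        (Real.exp (-‖Z‖ ^ 2) * h Z) • (t ^ k * Complex.exp (conj t * inner ℂ Z w)) := fun t ht => by
    rw [norm_smul, mem_sphere_zero_iff_norm.1 ht, abs_one, one_mul, inner_smul_left, hk,
      Complex.real_smul, smul_eq_mul]
    ring
  beta_reduce
  rw [Real.circleAverage_congr_sphere hsphere, Real.circleAverage_fun_smul,
    circleAverage_pow_mul_cexp_conj]
  have : (k.factorial : ℂ) ≠ 0 := by exact_mod_cast k.factorial_ne_zero
  simp only [smul_eq_mul, Complex.real_smul, Complex.ofReal_natCast]
  field_simp

end BargmannFock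

theorem sq_integral_norm_le_measureReal_univ_mul {α F : Type*} [MeasurableSpace α]
    [NormedAddCommGroup F] {ν : Measure α} [IsFiniteMeasure ν] {f : α → F} (hf : MemLp f 2 ν) :
    (∫ x, ‖f x‖ ∂ν) ^ 2 ≤ ν.real Set.univ * ∫ x, ‖f x‖ ^ 2 ∂ν := by
  have h := integral_mul_le_Lp_mul_Lq_of_nonneg (μ := ν) (f := fun _ => 1) (g := fun x => ‖f x‖)
    Real.HolderConjugate.two_two (.of_forall fun _ => zero_le_one)
    (.of_forall fun x => norm_nonneg (f x)) (by simpa using memLp_const 1)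
    (by simpa using hf.norm)
  simp only [one_mul, Real.rpow_two, one_pow, integral_const, smul_eq_mul, mul_one,
    ← Real.sqrt_eq_rpow] at h
  calc (∫ x, ‖f x‖ ∂ν) ^ 2 ≤ (√(ν.real Set.univ) * √(∫ x, ‖f x‖ ^ 2 ∂ν)) ^ 2 := by gcongr
    _ = _ := by
      rw [mul_pow, Real.sq_sqrt measureReal_nonneg,
        Real.sq_sqrt (integral_nonneg fun _ => by positivity)]

section HomogeneousPart

open Metric Module

/-- The homogeneous part of degree `k` of the Taylor expansion of `g` at the origin, read off from
the restrictions of `g` to complex lines. -/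
noncomputable def homogeneousPart {W : Type*} [AddCommGroup W] [Module ℂ W] (g : W → ℂ) (k : ℕ)
    (Z : W) : ℂ :=
  (k.factorial : ℂ)⁻¹ * iteratedDeriv k (fun t : ℂ => g (t • Z)) 0

theorem iteratedDeriv_comp_mul_left {𝕜 F : Type*} [NontriviallyNormedField 𝕜]
    [NormedAddCommGroup F] [NormedSpace 𝕜 F] (k : ℕ) (c : 𝕜) (f : 𝕜 → F) :
    iteratedDeriv k (fun x => f (c * x)) = fun x => c ^ k • iteratedDeriv k f (c * x) := by
  induction k with
  | zero => simp
  | succ k ih =>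
    ext x
    rw [iteratedDeriv_succ, ih, deriv_fun_const_smul_field, deriv_comp_mul_left,
      ← iteratedDeriv_succ, smul_smul, pow_succ]

theorem homogeneousPart_smul {W : Type*} [AddCommGroup W] [Module ℂ W] (g : W → ℂ) (k : ℕ) (a : ℂ)
    (Z : W) : homogeneousPart g k (a • Z) = a ^ k * homogeneousPart g k Z := by
  have h := congrFun (iteratedDeriv_comp_mul_left k a fun t => g (t • Z)) 0
  simp only [mul_comm a, mul_smul, smul_eq_mul, zero_mul] at h
  rw [homogeneousPart, homogeneousPart, h, mul_left_comm]

section NormedSpace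

variable {W : Type*} [NormedAddCommGroup W] [NormedSpace ℂ W] {g : W → ℂ} {r : ℝ}

theorem hasSum_homogeneousPart (hg : DifferentiableOn ℂ g (ball 0 r)) {Z : W}
    (hZ : Z ∈ ball 0 r) : HasSum (fun k => homogeneousPart g k Z) (g Z) := by
  obtain ⟨s, hs, hs1⟩ : ∃ s : ℝ, s * ‖Z‖ < r ∧ 1 < s := by
    have hlim : Filter.Tendsto (· * ‖Z‖) (𝓝[>] (1 : ℝ)) (𝓝 (1 * ‖Z‖)) :=
      (continuousAt_id.mul continuousAt_const).continuousWithinAt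
    exact ((hlim.eventually_lt_const (by simpa using hZ)).and self_mem_nhdsWithin).exists
  have hd : DifferentiableOn ℂ (fun t : ℂ => g (t • Z)) (ball 0 s) :=
    hg.comp (by fun_prop) fun t ht => by
      rw [mem_ball_zero_iff] at ht ⊢
      rw [norm_smul]
      exact (mul_le_mul_of_nonneg_right ht.le (norm_nonneg Z)).trans_lt hs
  simpa [homogeneousPart] using Complex.hasSum_taylorSeries_on_ball hd (z := 1) (by simpa using hs1)

theorem differentiable_homogeneousPart (hr : 0 < r) (hg : DifferentiableOn ℂ g (ball 0 r))
    (k : ℕ) : Differentiable ℂ (homogeneousPart g k) := by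
  set U : Set (W × ℂ) := (fun x => x.2 • x.1) ⁻¹' ball 0 r
  have hU : IsOpen U := isOpen_ball.preimage (by fun_prop)
  have hd := differentiableOn_iteratedDeriv_snd (g := fun x => g (x.2 • x.1)) hU
    (hg.comp (by fun_prop) fun x hx => hx) k
  exact fun Z => (((hd.differentiableAt (hU.mem_nhds (by simpa [U] using hr))).comp Z
    (f := fun Z => (Z, (0 : ℂ))) (by fun_prop))).const_mul _

theorem circleAverage_conj_pow_mul_comp_smul (hg : DifferentiableOn ℂ g (ball 0 r)) {Z : W}
    (hZ : Z ∈ ball 0 r) (k : ℕ) :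
    Real.circleAverage (fun t => conj t ^ k * g (t • Z)) 0 1 = homogeneousPart g k Z := by
  refine circleAverage_conj_pow_mul (DifferentiableOn.diffContOnCl
    (hg.comp (by fun_prop) fun t ht => ?_)) k
  rw [closure_ball _ one_ne_zero, mem_closedBall_zero_iff] at ht
  rw [mem_ball_zero_iff] at hZ ⊢
  rw [norm_smul]
  exact (mul_le_of_le_one_left (norm_nonneg Z) ht).trans_lt hZ

end NormedSpace

variable {W : Type*} [NormedAddCommGroup W] [InnerProductSpace ℂ W]

theorem norm_inner_pow_le_of_mem_ball {r : ℝ} {Z : W} (hZ : Z ∈ ball 0 r) (w : W) (k : ℕ) :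
    ‖inner ℂ Z w ^ k‖ ≤ (r * ‖w‖) ^ k := by
  rw [norm_pow]
  rw [mem_ball_zero_iff] at hZ
  gcongr
  exact (norm_inner_le_norm Z w).trans (by gcongr)

theorem smul_mul_inner_smul_pow {h : W → ℂ} {k : ℕ} (hk : ∀ (t : ℂ) Z, h (t • Z) = t ^ k * h Z)
    (c : ℝ) (Z w : W) :
    h (c • Z) * inner ℂ (c • Z) w ^ k = c ^ (2 * k) • (h Z * inner ℂ Z w ^ k) := by
  rw [← Complex.coe_smul, hk, inner_smul_left, Complex.conj_ofReal, Complex.real_smul]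
  push_cast
  ring

variable [FiniteDimensional ℂ W] [MeasurableSpace W] [BorelSpace W] (μ : Measure W)
  [μ.IsAddHaarMeasure]

theorem integral_exp_neg_norm_sq :
    ∫ Z : W, Real.exp (-‖Z‖ ^ 2) ∂μ = (finrank ℂ W).factorial * μ.real (ball 0 1) := by
  have : FiniteDimensional ℝ W := FiniteDimensional.complexToReal W
  have h := integral_exp_neg_norm_sq_smul_of_homogeneous μ (φ := fun _ : W => (1 : ℝ))
    continuous_const (k := 0) (by simp)
  rw [finrank_real_of_complex] at h
  simpa [Real.Gamma_nat_eq_factorial] using h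

theorem setIntegral_unitBall_mul_inner_pow {h : W → ℂ} (hh : Differentiable ℂ h) {k : ℕ}
    (hk : ∀ (t : ℂ) Z, h (t • Z) = t ^ k * h Z) (w : W) :
    ((k + finrank ℂ W).choose (finrank ℂ W) : ℂ) * ∫ Z in ball 0 1, h Z * inner ℂ Z w ^ k ∂μ =
      μ.real (ball 0 1) * h w := by
  have : FiniteDimensional ℝ W := FiniteDimensional.complexToReal W
  have hgauss := integral_exp_neg_norm_sq_smul_of_homogeneous μ
    (φ := fun Z => h Z * inner ℂ Z w ^ k) (hh.continuous.mul (by fun_prop))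
    fun c Z => smul_mul_inner_smul_pow hk c Z w
  rw [integral_exp_neg_norm_sq_smul_mul_inner_pow μ hh hk, integral_exp_neg_norm_sq,
    finrank_real_of_complex, show ((2 * k + 2 * finrank ℂ W : ℕ) : ℝ) / 2 = (k + finrank ℂ W : ℕ) by
      push_cast; ring,
    Real.Gamma_nat_eq_factorial, ← Nat.add_choose_mul_factorial_mul_factorial] at hgauss
  have hfac : (k.factorial * (finrank ℂ W).factorial : ℂ) ≠ 0 := by
    exact_mod_cast mul_ne_zero k.factorial_ne_zero (finrank ℂ W).factorial_ne_zero
  refine mul_left_cancel₀ hfac ?_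
  simp only [Complex.real_smul] at hgauss
  push_cast at hgauss
  linear_combination -hgauss

theorem setIntegral_homogeneousPart_mul_inner_pow {g : W → ℂ} {r : ℝ}
    (hg : DifferentiableOn ℂ g (ball 0 r)) (hint : IntegrableOn g (ball 0 r) μ) (k : ℕ) (w : W) :
    ∫ Z in ball 0 r, homogeneousPart g k Z * inner ℂ Z w ^ k ∂μ =
      ∫ Z in ball 0 r, g Z * inner ℂ Z w ^ k ∂μ := by
  have : ProperSpace W := FiniteDimensional.proper ℂ W
  have hi : IntegrableOn (fun Z => g Z * inner ℂ Z w ^ k) (ball 0 r) μ :=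
    Integrable.mul_bdd hint (by fun_prop) ((ae_restrict_mem measurableSet_ball).mono
      fun Z hZ => norm_inner_pow_le_of_mem_ball hZ w k)
  rw [← integral_circleAverage_smul hi]
  refine setIntegral_congr_fun measurableSet_ball fun Z hZ => ?_
  rw [← circleAverage_conj_pow_mul_comp_smul hg hZ k, mul_comm, ← smul_eq_mul,
    ← Real.circleAverage_fun_smul]
  simp only [inner_smul_left, mul_pow, smul_eq_mul]
  congr! 2
  ring

theorem setIntegral_ball_mul_inner_pow {g : W → ℂ} {r : ℝ} (hr : 0 < r)
    (hg : DifferentiableOn ℂ g (ball 0 r)) (hint : IntegrableOn g (ball 0 r) μ) (k : ℕ) (w : W) :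
    ((k + finrank ℂ W).choose (finrank ℂ W) : ℂ) * ∫ Z in ball 0 r, g Z * inner ℂ Z w ^ k ∂μ =
      (r ^ 2) ^ (k + finrank ℂ W) * μ.real (ball 0 1) * homogeneousPart g k w := by
  have : FiniteDimensional ℝ W := FiniteDimensional.complexToReal W
  have hk := homogeneousPart_smul g k
  rw [← setIntegral_homogeneousPart_mul_inner_pow μ hg hint,
    setIntegral_ball_of_homogeneous μ (fun c Z => smul_mul_inner_smul_pow hk c Z w) hr,
    Complex.real_smul, mul_left_comm, setIntegral_unitBall_mul_inner_pow μ
      (differentiable_homogeneousPart hr hg k) hk, finrank_real_of_complex, ← mul_add]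
  push_cast
  ring

theorem sq_norm_setIntegral_ball_mul_inner_pow_le {g : W → ℂ} {r : ℝ} (hr : 0 < r)
    (hg : MemLp g 2 (μ.restrict (ball 0 r))) (k : ℕ) (w : W) :
    ‖∫ Z in ball 0 r, g Z * inner ℂ Z w ^ k ∂μ‖ ^ 2 ≤
      μ.real (ball 0 1) * (r ^ 2) ^ (k + finrank ℂ W) * (‖w‖ ^ k) ^ 2 *
        ∫ Z in ball 0 r, ‖g Z‖ ^ 2 ∂μ := by
  have : FiniteDimensional ℝ W := FiniteDimensional.complexToReal W
  have : ProperSpace W := FiniteDimensional.proper ℂ W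
  have : IsFiniteMeasure (μ.restrict (ball 0 r)) := ⟨by simpa using measure_ball_lt_top⟩
  have hvol : (μ.restrict (ball 0 r)).real Set.univ =
      (r ^ 2) ^ finrank ℂ W * μ.real (ball 0 1) := by
    rw [measureReal_restrict_apply_univ, measureReal_def, μ.addHaar_ball_of_pos 0 hr,
      finrank_real_of_complex, ENNReal.toReal_mul, ENNReal.toReal_ofReal (by positivity), pow_mul,
      measureReal_def]
  have hle : ‖∫ Z in ball 0 r, g Z * inner ℂ Z w ^ k ∂μ‖ ≤
      (r * ‖w‖) ^ k * ∫ Z in ball 0 r, ‖g Z‖ ∂μ := by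
    rw [← integral_const_mul]
    refine norm_integral_le_of_norm_le ((hg.integrable one_le_two).norm.const_mul _)
      ((ae_restrict_mem measurableSet_ball).mono fun Z hZ => ?_)
    rw [norm_mul, mul_comm]
    gcongr
    exact norm_inner_pow_le_of_mem_ball hZ w k
  calc ‖∫ Z in ball 0 r, g Z * inner ℂ Z w ^ k ∂μ‖ ^ 2
      ≤ ((r * ‖w‖) ^ k) ^ 2 * (∫ Z in ball 0 r, ‖g Z‖ ∂μ) ^ 2 := by
        rw [← mul_pow]
        gcongr
    _ ≤ ((r * ‖w‖) ^ k) ^ 2 *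
        ((r ^ 2) ^ finrank ℂ W * μ.real (ball 0 1) * ∫ Z in ball 0 r, ‖g Z‖ ^ 2 ∂μ) := by
      rw [← hvol]
      gcongr
      exact sq_integral_norm_le_measureReal_univ_mul hg
    _ = _ := by ring

theorem pow_mul_norm_homogeneousPart_sq_le {g : W → ℂ} {r : ℝ} (hr : 0 < r)
    (hg : DifferentiableOn ℂ g (ball 0 r)) (hg2 : MemLp g 2 (μ.restrict (ball 0 r))) (k : ℕ)
    (w : W) :
    μ.real (ball 0 1) * (r ^ 2) ^ (k + finrank ℂ W) * ‖homogeneousPart g k w‖ ^ 2 ≤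
      ((k + finrank ℂ W).choose (finrank ℂ W) * ‖w‖ ^ k) ^ 2 * ∫ Z in ball 0 r, ‖g Z‖ ^ 2 ∂μ := by
  have : ProperSpace W := FiniteDimensional.proper ℂ W
  have : IsFiniteMeasure (μ.restrict (ball 0 r)) := ⟨by simpa using measure_ball_lt_top⟩
  set d := finrank ℂ W with hd
  set N := μ.real (ball 0 1) with hN
  have hN0 : 0 < N := ENNReal.toReal_pos (measure_ball_pos μ 0 one_pos).ne' measure_ball_lt_top.ne
  have hcoef := congrArg norm
    (setIntegral_ball_mul_inner_pow μ hr hg (hg2.integrable one_le_two) k w)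
  rw [← hd, ← hN] at hcoef
  simp only [norm_mul, norm_pow, Complex.norm_natCast, Complex.norm_real,
    Real.norm_of_nonneg hr.le, Real.norm_of_nonneg hN0.le] at hcoef
  refine le_of_mul_le_mul_left ?_ (show 0 < N * (r ^ 2) ^ (k + d) by positivity)
  calc N * (r ^ 2) ^ (k + d) * (N * (r ^ 2) ^ (k + d) * ‖homogeneousPart g k w‖ ^ 2)
      = ((k + d).choose d * ‖∫ Z in ball 0 r, g Z * inner ℂ Z w ^ k ∂μ‖) ^ 2 := by
        rw [hcoef]
        ring
    _ ≤ (k + d).choose d ^ 2 * (N * (r ^ 2) ^ (k + d) * (‖w‖ ^ k) ^ 2 *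
        ∫ Z in ball 0 r, ‖g Z‖ ^ 2 ∂μ) := by
      rw [mul_pow]
      gcongr
      exact sq_norm_setIntegral_ball_mul_inner_pow_le μ hr hg2 k w
    _ = _ := by ring

end HomogeneousPart

section HermitianVolume

open Metric Module

variable {W : Type*} [NormedAddCommGroup W] [InnerProductSpace ℂ W] [FiniteDimensional ℂ W]
  [MeasurableSpace W] [BorelSpace W]

instance isAddHaarMeasure_hermitianVolume : (hermitianVolume W).IsAddHaarMeasure := by
  let : InnerProductSpace ℝ W := InnerProductSpace.rclikeToReal ℂ W
  have : FiniteDimensional ℝ W := FiniteDimensional.complexToReal W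
  exact Measure.IsAddHaarMeasure.smul _ (ENNReal.ofReal_pos.2 (by positivity)).ne'
    ENNReal.ofReal_ne_top

theorem hermitianVolume_unitBall : hermitianVolume W (ball 0 1) = 1 := by
  let : InnerProductSpace ℝ W := InnerProductSpace.rclikeToReal ℂ W
  have : FiniteDimensional ℝ W := FiniteDimensional.complexToReal W
  rw [hermitianVolume, Measure.smul_apply]
  cases subsingleton_or_nontrivial W
  · have hball : ball (0 : W) 1 = parallelepiped (stdOrthonormalBasis ℝ W) :=
      Set.Nonempty.eq_univ ⟨0, mem_ball_self one_pos⟩ |>.trans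
        (Set.Nonempty.eq_univ ⟨_, Set.mem_image_of_mem _ (Set.left_mem_Icc.2 zero_le_one)⟩).symm
    rw [hball, OrthonormalBasis.volume_parallelepiped, finrank_zero_of_subsingleton]
    simp
  · have h := InnerProductSpace.volume_ball_of_dim_even (E := W) (finrank_real_of_complex W) 0 1
    rw [h, ENNReal.ofReal_one, one_pow, one_mul, smul_eq_mul,
      ← ENNReal.ofReal_mul (by positivity), div_mul_div_comm, mul_comm, div_self (by positivity),
      ENNReal.ofReal_one]

end HermitianVolume

section HartogsDomain

open Metric Module Filter

/-- The Hartogs domain over `Ω` whose fibre over `z` is the ball of radius `√(p z)` in `W`; for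
`W = ℂ ^ m` it is the inflated domain. -/
def hartogsDomain {V : Type*} (W : Type*) [Norm W] (Ω : Set V) (p : V → ℝ) : Set (V × W) :=
  {x | x.1 ∈ Ω ∧ ‖x.2‖ ^ 2 < p x.1}

theorem norm_inner_lt_of_mem_hartogsDomain {V W : Type*} [SeminormedAddCommGroup W]
    [InnerProductSpace ℂ W] {Ω : Set V} {p : V → ℝ} {x y : V × W}
    (hx : x ∈ hartogsDomain W Ω p) (hy : y ∈ hartogsDomain W Ω p) :
    ‖inner ℂ y.2 x.2‖ < √(p x.1) * √(p y.1) := by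
  rw [mul_comm]
  exact (norm_inner_le_norm y.2 x.2).trans_lt (mul_lt_mul''
    (Real.lt_sqrt (norm_nonneg _) |>.2 hy.2) (Real.lt_sqrt (norm_nonneg _) |>.2 hx.2)
    (norm_nonneg _) (norm_nonneg _))

section Fibres

variable {V W : Type*} [SeminormedAddCommGroup W] {Ω : Set V} {p : V → ℝ}

theorem preimage_prodMk_hartogsDomain {z : V} (hz : z ∈ Ω) :
    Prod.mk z ⁻¹' hartogsDomain W Ω p = ball 0 √(p z) := by
  ext Z
  simp [hartogsDomain, hz, Real.lt_sqrt (norm_nonneg Z)]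

theorem preimage_prodMk_hartogsDomain_of_notMem {z : V} (hz : z ∉ Ω) :
    Prod.mk z ⁻¹' hartogsDomain W Ω p = ∅ := by
  ext Z
  simp [hartogsDomain, hz]

theorem isOpen_hartogsDomain [TopologicalSpace V] (hΩ : IsOpen Ω) (hp : ContinuousOn p Ω) :
    IsOpen (hartogsDomain W Ω p) := by
  have h : ContinuousOn (fun x : V × W => p x.1 - ‖x.2‖ ^ 2) (Prod.fst ⁻¹' Ω) :=
    (hp.comp continuousOn_fst fun x hx => hx).sub (by fun_prop)
  convert h.isOpen_inter_preimage (hΩ.preimage continuous_fst) (isOpen_Ioi (a := 0)) using 1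
  ext x
  simp [hartogsDomain]

variable [MeasurableSpace V] [MeasurableSpace W] {μ : Measure V}
  {ν : Measure W} [SFinite ν] {F : Type*} [NormedAddCommGroup F] {f : V × W → F}

theorem integrableOn_hartogsDomain_iff (hΩ : MeasurableSet Ω)
    (hD : MeasurableSet (hartogsDomain W Ω p))
    (hf : AEStronglyMeasurable f ((μ.prod ν).restrict (hartogsDomain W Ω p))) :
    IntegrableOn f (hartogsDomain W Ω p) (μ.prod ν) ↔
      (∀ᵐ z ∂μ.restrict Ω, IntegrableOn (fun Z => f (z, Z)) (ball 0 √(p z)) ν) ∧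
        IntegrableOn (fun z => ∫ Z in ball 0 √(p z), ‖f (z, Z)‖ ∂ν) Ω μ := by
  rw [integrableOn_prod_iff_slice hD hf, ae_restrict_iff' hΩ, ← integrable_indicator_iff hΩ]
  refine and_congr (eventually_congr (.of_forall fun z => ?_))
    (integrable_congr (.of_forall fun z => ?_))
  · by_cases hz : z ∈ Ω
    · simp only [preimage_prodMk_hartogsDomain hz, hz, true_imp_iff]
    · simp [preimage_prodMk_hartogsDomain_of_notMem hz, hz]
  · by_cases hz : z ∈ Ω
    · simp only [preimage_prodMk_hartogsDomain hz, Set.indicator_of_mem hz]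
    · simp [preimage_prodMk_hartogsDomain_of_notMem hz, hz]

theorem setIntegral_hartogsDomain [SFinite μ] [NormedSpace ℝ F]
    (hΩ : MeasurableSet Ω) (hD : MeasurableSet (hartogsDomain W Ω p))
    (hf : IntegrableOn f (hartogsDomain W Ω p) (μ.prod ν)) :
    ∫ x in hartogsDomain W Ω p, f x ∂(μ.prod ν) =
      ∫ z in Ω, ∫ Z in ball 0 √(p z), f (z, Z) ∂ν ∂μ := by
  rw [setIntegral_prod_slice hD hf, ← setIntegral_eq_integral_of_forall_compl_eq_zero (s := Ω)
    fun z hz => by simp [preimage_prodMk_hartogsDomain_of_notMem hz]]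
  refine setIntegral_congr_fun hΩ fun z hz => ?_
  simp only [preimage_prodMk_hartogsDomain hz]

end Fibres

section Kernel

variable {V W : Type*} [NormedAddCommGroup V] [NormedSpace ℂ V] [NormedAddCommGroup W]
  {Ω : Set V} {p : V → ℝ} {f : V × W → ℂ}

theorem differentiableOn_slice_hartogsDomain [NormedSpace ℂ W]
    (hf : DifferentiableOn ℂ f (hartogsDomain W Ω p)) {z : V} (hz : z ∈ Ω) :
    DifferentiableOn ℂ (fun Z => f (z, Z)) (ball 0 √(p z)) :=
  hf.comp (by fun_prop) (preimage_prodMk_hartogsDomain hz).ge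

theorem differentiableOn_homogeneousPart_slice [NormedSpace ℂ W]
    (hΩ : IsOpen Ω) (hp : ContinuousOn p Ω) (hp0 : ∀ z ∈ Ω, 0 < p z)
    (hf : DifferentiableOn ℂ f (hartogsDomain W Ω p)) (k : ℕ) (w : W) :
    DifferentiableOn ℂ (fun z => homogeneousPart (fun Z => f (z, Z)) k w) Ω := by
  have h := differentiableOn_iteratedDeriv_snd (g := fun x : V × ℂ => f (x.1, x.2 • w))
    ((isOpen_hartogsDomain hΩ hp).preimage (f := fun x : V × ℂ => (x.1, x.2 • w)) (by fun_prop))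
    (hf.comp (by fun_prop) fun x hx => hx) k
  exact (h.comp (f := fun z => (z, (0 : ℂ))) (by fun_prop) fun z hz =>
    ⟨hz, by simpa using hp0 z hz⟩).const_mul _

theorem memLp_two_of_memBergman_one {E : Type*} [NormedAddCommGroup E] [NormedSpace ℂ E]
    [MeasurableSpace E] [OpensMeasurableSpace E] {μ : Measure E} {D : Set E}
    (hD : MeasurableSet D) {f : E → ℂ} (hf : MemBergman μ D (fun _ => 1) f) :
    MemLp f 2 (μ.restrict D) :=
  (memLp_two_iff_integrable_sq_norm (hf.1.continuousOn.aestronglyMeasurable hD)).2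
    (by simpa only [mul_one] using hf.2.integrable)

variable [InnerProductSpace ℂ W] [FiniteDimensional ℂ V] [FiniteDimensional ℂ W]
  [MeasurableSpace V] [BorelSpace V] [MeasurableSpace W] [BorelSpace W]
  {μ : Measure V} {ν : Measure W} [ν.IsAddHaarMeasure]

theorem measurableSet_hartogsDomain (hΩ : IsOpen Ω) (hp : ContinuousOn p Ω) :
    MeasurableSet (hartogsDomain W Ω p) := by
  have : ProperSpace V := FiniteDimensional.proper ℂ V
  exact (isOpen_hartogsDomain hΩ hp).measurableSet

theorem memBergman_mul_inner_pow (hΩ : IsOpen Ω) (hp : ContinuousOn p Ω)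
    (hp0 : ∀ z ∈ Ω, 0 < p z) {h : V → ℂ} {k : ℕ}
    (hh : MemBergman μ Ω (fun z => p z ^ (k + finrank ℂ W)) h) (w : W) :
    MemBergman (μ.prod ν) (hartogsDomain W Ω p) (fun _ => 1)
      (fun x => h x.1 * inner ℂ w x.2 ^ k) := by
  have : ProperSpace V := FiniteDimensional.proper ℂ V
  have : ProperSpace W := FiniteDimensional.proper ℂ W
  have : FiniteDimensional ℝ W := FiniteDimensional.complexToReal W
  have hD := measurableSet_hartogsDomain (W := W) hΩ hp
  have hd : DifferentiableOn ℂ (fun x : V × W => h x.1 * inner ℂ w x.2 ^ k)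
      (hartogsDomain W Ω p) :=
    (hh.1.comp (by fun_prop) fun x hx => hx.1).mul
      (((innerSL ℂ w).differentiable.comp differentiable_snd).pow k).differentiableOn
  have hm : AEStronglyMeasurable (fun x : V × W => ‖h x.1 * inner ℂ w x.2 ^ k‖ ^ 2 * 1)
      ((μ.prod ν).restrict (hartogsDomain W Ω p)) :=
    ((hd.continuousOn.norm.pow 2).mul continuousOn_const).aestronglyMeasurable hD
  refine ⟨hd, (integrableOn_hartogsDomain_iff hΩ.measurableSet hD hm).2 ⟨?_, ?_⟩⟩
  · have hcont (z : V) : Continuous fun Z : W => ‖h z * inner ℂ w Z ^ k‖ ^ 2 * 1 := by fun_prop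
    exact .of_forall fun z => ((hcont z).continuousOn.integrableOn_compact
      (isCompact_closedBall 0 √(p z))).mono_set ball_subset_closedBall
  · have hφ : ∀ (c : ℝ) (Z : W), ‖inner ℂ w (c • Z) ^ k‖ ^ 2 =
        c ^ (2 * k) • ‖inner ℂ w Z ^ k‖ ^ 2 := fun c Z => by
      rw [← Complex.coe_smul, inner_smul_right, mul_pow, norm_mul, mul_pow, norm_pow,
        Complex.norm_real, ← pow_mul, mul_comm k, pow_mul, Real.norm_eq_abs, sq_abs, ← pow_mul,
        smul_eq_mul]
    refine IntegrableOn.congr_fun (hh.2.mul_const (∫ Z in ball 0 1, ‖inner ℂ w Z ^ k‖ ^ 2 ∂ν))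
      (fun z hz => ?_) hΩ.measurableSet
    have hscale := setIntegral_ball_of_homogeneous (φ := fun Z => ‖inner ℂ w Z ^ k‖ ^ 2) ν hφ
      (Real.sqrt_pos.2 (hp0 z hz))
    rw [finrank_real_of_complex, ← mul_add, pow_mul, Real.sq_sqrt (hp0 z hz).le, smul_eq_mul]
      at hscale
    simp only [mul_one, norm_mul, mul_pow, norm_norm, norm_pow ‖_‖ 2, integral_const_mul]
    rw [hscale, mul_assoc]

theorem memBergman_homogeneousPart (hΩ : IsOpen Ω)
    (hp : ContinuousOn p Ω) (hp0 : ∀ z ∈ Ω, 0 < p z)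
    (hf : MemBergman (μ.prod ν) (hartogsDomain W Ω p) (fun _ => 1) f) (k : ℕ) (w : W) :
    MemBergman μ Ω (fun z => p z ^ (k + finrank ℂ W))
      (fun z => homogeneousPart (fun Z => f (z, Z)) k w) := by
  have : ProperSpace V := FiniteDimensional.proper ℂ V
  have : ProperSpace W := FiniteDimensional.proper ℂ W
  have hD := measurableSet_hartogsDomain (W := W) hΩ hp
  have hd := differentiableOn_homogeneousPart_slice hΩ hp hp0 hf.1 k w
  have hN : 0 < ν.real (ball 0 1) :=
    ENNReal.toReal_pos (measure_ball_pos ν 0 one_pos).ne' measure_ball_lt_top.ne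
  have hslice := (integrableOn_hartogsDomain_iff hΩ.measurableSet hD hf.2.aestronglyMeasurable).1
    hf.2
  refine ⟨hd, (hslice.2.const_mul (((k + finrank ℂ W).choose (finrank ℂ W) * ‖w‖ ^ k) ^ 2 /
    ν.real (ball 0 1))).mono' (((hd.continuousOn.norm.pow 2).mul (hp.pow _)).aestronglyMeasurable
      hΩ.measurableSet) ?_⟩
  filter_upwards [ae_restrict_mem hΩ.measurableSet, hslice.1] with z hz hzi
  have hpz := hp0 z hz
  have hzd := differentiableOn_slice_hartogsDomain hf.1 hz
  have hle := pow_mul_norm_homogeneousPart_sq_le ν (Real.sqrt_pos.2 hpz) hzd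
    (memLp_two_of_memBergman_one measurableSet_ball ⟨hzd, hzi⟩) k w
  simp only [mul_one, norm_pow, norm_norm]
  rw [Real.norm_of_nonneg (by positivity), div_mul_eq_mul_div, le_div_iff₀ hN]
  rw [Real.sq_sqrt hpz.le] at hle
  linarith

variable [SFinite μ]

theorem setIntegral_mul_conj_kernel_mul_inner_pow (hΩ : IsOpen Ω)
    (hp : ContinuousOn p Ω) (hp0 : ∀ z ∈ Ω, 0 < p z)
    (hf : MemBergman (μ.prod ν) (hartogsDomain W Ω p) (fun _ => 1) f) {k : ℕ} {K : V → V → ℂ}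
    (hK : IsBergmanKernel μ Ω (fun z => p z ^ (k + finrank ℂ W)) K) {z₀ : V} (hz₀ : z₀ ∈ Ω)
    (w : W) :
    ((k + finrank ℂ W).choose (finrank ℂ W) : ℂ) *
        ∫ x in hartogsDomain W Ω p, f x * conj (K x.1 z₀ * inner ℂ w x.2 ^ k) ∂(μ.prod ν) =
      ν.real (ball 0 1) * homogeneousPart (fun Z => f (z₀, Z)) k w := by
  have : ProperSpace V := FiniteDimensional.proper ℂ V
  have : ProperSpace W := FiniteDimensional.proper ℂ W
  have hD := measurableSet_hartogsDomain (W := W) hΩ hp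
  have hG := memBergman_mul_inner_pow (ν := ν) hΩ hp hp0 (hK z₀ hz₀).1 w
  have hint : IntegrableOn (fun x => f x * conj (K x.1 z₀ * inner ℂ w x.2 ^ k))
      (hartogsDomain W Ω p) (μ.prod ν) :=
    (memLp_two_of_memBergman_one hD hf).integrable_mul (memLp_two_of_memBergman_one hD hG).star
  have hslice := (integrableOn_hartogsDomain_iff hΩ.measurableSet hD hf.2.aestronglyMeasurable).1
    hf.2
  rw [setIntegral_hartogsDomain hΩ.measurableSet hD hint, (hK z₀ hz₀).2 _
    (memBergman_homogeneousPart hΩ hp hp0 hf k w), ← integral_const_mul, ← integral_const_mul]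
  refine integral_congr_ae ?_
  filter_upwards [ae_restrict_mem hΩ.measurableSet, hslice.1] with z hz hzi
  have hzd := differentiableOn_slice_hartogsDomain hf.1 hz
  have : IsFiniteMeasure (ν.restrict (ball 0 √(p z))) := ⟨by simpa using measure_ball_lt_top⟩
  have hfibre := setIntegral_ball_mul_inner_pow ν (Real.sqrt_pos.2 (hp0 z hz)) hzd
    ((memLp_two_of_memBergman_one measurableSet_ball ⟨hzd, hzi⟩).integrable one_le_two) k w
  have hconj : ∀ Z : W, f (z, Z) * conj (K z z₀ * inner ℂ w Z ^ k) =
      conj (K z z₀) * (f (z, Z) * inner ℂ Z w ^ k) := fun Z => by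
    rw [map_mul, map_pow, inner_conj_symm]
    ring
  simp only [hconj]
  rw [integral_const_mul, mul_left_comm, hfibre, ← Complex.ofReal_pow,
    Real.sq_sqrt (hp0 z hz).le]
  push_cast
  ring

theorem measureReal_unitBall_mul_homogeneousPart_kernel (hΩ : IsOpen Ω) (hp : ContinuousOn p Ω)
    (hp0 : ∀ z ∈ Ω, 0 < p z) {k : ℕ} {K : V → V → ℂ}
    (hK : IsBergmanKernel μ Ω (fun z => p z ^ (k + finrank ℂ W)) K) {L : V × W → V × W → ℂ}
    (hL : IsBergmanKernel (μ.prod ν) (hartogsDomain W Ω p) (fun _ => 1) L)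
    {z : V} (hz : z ∈ Ω) (Z : W) {y : V × W} (hy : y ∈ hartogsDomain W Ω p) :
    ν.real (ball 0 1) * homogeneousPart (fun Z => L (z, Z) y) k Z =
      (k + finrank ℂ W).choose (finrank ℂ W) * K z y.1 * inner ℂ y.2 Z ^ k := by
  have heval := congrArg conj
    ((hL y hy).2 _ (memBergman_mul_inner_pow (ν := ν) hΩ hp hp0 (hK z hz).1 Z))
  rw [← integral_conj] at heval
  simp only [map_mul, Complex.conj_conj, map_pow, inner_conj_symm,
    conj_kernel_eq_of_isBergmanKernel hK hy.1 hz, Complex.ofReal_one, mul_one] at heval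
  rw [← setIntegral_mul_conj_kernel_mul_inner_pow hΩ hp hp0 (hL y hy).1 hK hz Z, mul_assoc, heval]
  congr! 3
  rw [map_mul, map_pow, inner_conj_symm, mul_comm]

theorem hasSum_kernel_hartogsDomain (hΩ : IsOpen Ω) (hp : ContinuousOn p Ω)
    (hp0 : ∀ z ∈ Ω, 0 < p z) {K : ℕ → V → V → ℂ}
    (hK : ∀ k, IsBergmanKernel μ Ω (fun z => p z ^ k) (K k)) {L : V × W → V × W → ℂ}
    (hL : IsBergmanKernel (μ.prod ν) (hartogsDomain W Ω p) (fun _ => 1) L)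
    {x y : V × W} (hx : x ∈ hartogsDomain W Ω p) (hy : y ∈ hartogsDomain W Ω p) :
    HasSum (fun k => ((k + finrank ℂ W).choose (finrank ℂ W) : ℂ) *
      K (k + finrank ℂ W) x.1 y.1 * inner ℂ y.2 x.2 ^ k) (ν.real (ball 0 1) * L x y) := by
  have hx2 : x.2 ∈ ball 0 √(p x.1) := (preimage_prodMk_hartogsDomain hx.1).le hx
  simpa only [measureReal_unitBall_mul_homogeneousPart_kernel hΩ hp hp0 (hK _) hL hx.1 x.2 hy]
    using (hasSum_homogeneousPart
      (differentiableOn_slice_hartogsDomain (hL y hy).1.1 hx.1) hx2).mul_left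
        (ν.real (ball 0 1) : ℂ)

end Kernel

section RadiusOfConvergence

variable {V : Type*} [NormedAddCommGroup V] [NormedSpace ℂ V] [FiniteDimensional ℂ V]
  [MeasurableSpace V] [BorelSpace V] {μ : Measure V} [μ.IsAddHaarMeasure] {Ω : Set V} {p : V → ℝ}

-- The Hartogs domain with fibres in `ℂ` contains points over `z` and `w` whose real fibre
-- coordinates `b` and `t / b` have product `t`, so its kernel expansion is a series in `t`.
theorem summable_norm_kernel_mul_pow (hΩ : IsOpen Ω) (hp : ContinuousOn p Ω)
    (hp0 : ∀ z ∈ Ω, 0 < p z) {K : ℕ → V → V → ℂ}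
    (hK : ∀ k, IsBergmanKernel μ Ω (fun z => p z ^ k) (K k)) {z w : V} (hz : z ∈ Ω) (hw : w ∈ Ω)
    {t : ℝ} (ht0 : 0 ≤ t) (ht : t < √(p z) * √(p w)) :
    Summable fun k => ‖K k z w‖ * t ^ k := by
  have : ProperSpace V := FiniteDimensional.proper ℂ V
  have hpw : 0 < √(p w) := Real.sqrt_pos.2 (hp0 w hw)
  obtain ⟨b, htb, hbz⟩ := exists_between ((div_lt_iff₀ hpw).2 ht)
  have hb0 : 0 < b := (by positivity : 0 ≤ t / √(p w)).trans_lt htb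
  have hc : t / b < √(p w) := (div_lt_comm₀ hb0 hpw).2 htb
  have hmem {x : V} {s : ℝ} (hx : x ∈ Ω) (hs0 : 0 ≤ s) (hs : s < √(p x)) :
      (x, (s : ℂ)) ∈ hartogsDomain ℂ Ω p :=
    (preimage_prodMk_hartogsDomain hx).ge (by simpa [abs_of_nonneg hs0] using hs)
  have h := (hasSum_kernel_hartogsDomain hΩ hp hp0 hK
    (isBergmanKernel_bergmanKernel (μ := μ.prod volume) (isOpen_hartogsDomain hΩ hp)
      continuousOn_const fun _ _ => one_pos)
    (hmem hz hb0.le hbz) (hmem hw (by positivity) hc)).summable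
  have hinner : inner ℂ ((t / b : ℝ) : ℂ) (b : ℂ) = (t : ℂ) := by
    rw [RCLike.inner_apply, Complex.conj_ofReal, ← Complex.ofReal_mul, mul_div_cancel₀ t hb0.ne']
  simp only [finrank_self, hinner] at h
  exact summable_norm_mul_pow_of_summable_choose_mul ht0 h

end RadiusOfConvergence

end HartogsDomain

section InflatedDomain

open Module

variable {V : Type*} [NormedAddCommGroup V] [InnerProductSpace ℂ V] [FiniteDimensional ℂ V]
  [MeasurableSpace V] [BorelSpace V] {Ω : Set V} {p : V → ℝ} {m : ℕ}

theorem isBergmanKernel_powerKernel (hΩ : IsOpen Ω) (hp : ContinuousOn p Ω)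
    (hp0 : ∀ z ∈ Ω, 0 < p z) (k : ℕ) :
    IsBergmanKernel (hermitianVolume V) Ω (fun z => p z ^ k) (powerKernel Ω p k) :=
  isBergmanKernel_bergmanKernel hΩ (hp.pow k) fun z hz => pow_pos (hp0 z hz) k

theorem isBergmanKernel_inflatedBergmanKernel (hΩ : IsOpen Ω) (hp : ContinuousOn p Ω) (m : ℕ) :
    IsBergmanKernel (inflatedVolume V m) (inflatedDomain Ω p m) (fun _ => 1)
      (inflatedBergmanKernel Ω p m) := by
  have : ProperSpace V := FiniteDimensional.proper ℂ V
  have : (inflatedVolume V m).IsAddHaarMeasure :=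
    inferInstanceAs ((hermitianVolume V).prod (hermitianVolume _)).IsAddHaarMeasure
  exact isBergmanKernel_bergmanKernel (isOpen_hartogsDomain hΩ hp) continuousOn_const
    fun _ _ => one_pos

theorem hasSum_inflatedBergmanKernel (hΩ : IsOpen Ω) (hp : ContinuousOn p Ω)
    (hp0 : ∀ z ∈ Ω, 0 < p z) {x y : V × EuclideanSpace ℂ (Fin m)}
    (hx : x ∈ inflatedDomain Ω p m) (hy : y ∈ inflatedDomain Ω p m) :
    HasSum (fun k => ((k + m).choose m : ℂ) * powerKernel Ω p (k + m) x.1 y.1 *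
      inner ℂ y.2 x.2 ^ k) (inflatedBergmanKernel Ω p m x y) := by
  have : ProperSpace V := FiniteDimensional.proper ℂ V
  simpa only [finrank_euclideanSpace, Fintype.card_fin, measureReal_def, hermitianVolume_unitBall,
    ENNReal.toReal_one, Complex.ofReal_one, one_mul] using
    hasSum_kernel_hartogsDomain hΩ hp hp0 (isBergmanKernel_powerKernel hΩ hp hp0)
      (isBergmanKernel_inflatedBergmanKernel hΩ hp m) hx hy

theorem summable_norm_powerKernel_mul_pow (hΩ : IsOpen Ω) (hp : ContinuousOn p Ω)
    (hp0 : ∀ z ∈ Ω, 0 < p z) {z w : V} (hz : z ∈ Ω) (hw : w ∈ Ω) (t : ℝ) (ht0 : 0 ≤ t)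
    (ht : t < √(p z) * √(p w)) : Summable fun k => ‖powerKernel Ω p k z w‖ * t ^ k :=
  summable_norm_kernel_mul_pow hΩ hp hp0 (isBergmanKernel_powerKernel hΩ hp hp0) hz hw ht0 ht

theorem analyticAt_virtualBergmanKernel (hΩ : IsOpen Ω) (hp : ContinuousOn p Ω)
    (hp0 : ∀ z ∈ Ω, 0 < p z) {z w : V} (hz : z ∈ Ω) (hw : w ∈ Ω) {r : ℂ}
    (hr : ‖r‖ < √(p z) * √(p w)) : AnalyticAt ℂ (virtualBergmanKernel Ω p z w) r :=
  analyticAt_tsum_mul_pow (summable_norm_powerKernel_mul_pow hΩ hp hp0 hz hw) hr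

theorem virtualBergmanDeriv_eq_tsum (hΩ : IsOpen Ω) (hp : ContinuousOn p Ω)
    (hp0 : ∀ z ∈ Ω, 0 < p z) {z w : V} (hz : z ∈ Ω) (hw : w ∈ Ω) {r : ℂ}
    (hr : ‖r‖ < √(p z) * √(p w)) :
    virtualBergmanDeriv Ω p m z w r =
      ∑' k, ((k + m).choose m : ℂ) * powerKernel Ω p (k + m) z w * r ^ k := by
  simp only [virtualBergmanDeriv, virtualBergmanKernel]
  rw [iteratedDeriv_tsum_mul_pow m (summable_norm_powerKernel_mul_pow hΩ hp hp0 hz hw) hr,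
    one_div, inv_mul_cancel_left₀ (mod_cast m.factorial_ne_zero)]

theorem diagVirtualBergmanDeriv_eq_virtualBergmanDeriv (hΩ : IsOpen Ω) (hp : ContinuousOn p Ω)
    (hp0 : ∀ z ∈ Ω, 0 < p z) {z : V} (hz : z ∈ Ω) {r : ℝ} (hr : |r| < p z) :
    diagVirtualBergmanDeriv Ω p m z r = virtualBergmanDeriv Ω p m z z r := by
  have hr' : ‖(r : ℂ)‖ < √(p z) * √(p z) := by
    rwa [Complex.norm_real, Real.norm_eq_abs, Real.mul_self_sqrt (hp0 z hz).le]
  exact congrArg _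
    (iteratedDeriv_comp_ofReal (analyticAt_virtualBergmanKernel hΩ hp hp0 hz hz hr') m)

theorem inflatedBergmanKernel_eq_virtualBergmanDeriv (hΩ : IsOpen Ω) (hp : ContinuousOn p Ω)
    (hp0 : ∀ z ∈ Ω, 0 < p z) {x y : V × EuclideanSpace ℂ (Fin m)}
    (hx : x ∈ inflatedDomain Ω p m) (hy : y ∈ inflatedDomain Ω p m) :
    inflatedBergmanKernel Ω p m x y = virtualBergmanDeriv Ω p m x.1 y.1 (inner ℂ y.2 x.2) := by
  rw [virtualBergmanDeriv_eq_tsum hΩ hp hp0 hx.1 hy.1 (norm_inner_lt_of_mem_hartogsDomain hx hy),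
    (hasSum_inflatedBergmanKernel hΩ hp hp0 hx hy).tsum_eq]

theorem inflatedBergmanKernel_self_eq_diagVirtualBergmanDeriv (hΩ : IsOpen Ω)
    (hp : ContinuousOn p Ω) (hp0 : ∀ z ∈ Ω, 0 < p z) {x : V × EuclideanSpace ℂ (Fin m)}
    (hx : x ∈ inflatedDomain Ω p m) :
    inflatedBergmanKernel Ω p m x x = diagVirtualBergmanDeriv Ω p m x.1 (‖x.2‖ ^ 2) := by
  rw [inflatedBergmanKernel_eq_virtualBergmanDeriv hΩ hp hp0 hx hx,
    diagVirtualBergmanDeriv_eq_virtualBergmanDeriv hΩ hp hp0 hx.1 (by simpa using hx.2),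
    inner_self_eq_norm_sq_to_K, Complex.ofReal_pow]
  rfl

end InflatedDomain

theorem theorem1_general {V : Type*} [NormedAddCommGroup V] [InnerProductSpace ℂ V]
    [FiniteDimensional ℂ V] [MeasurableSpace V] [BorelSpace V]
    (Ω : Set V) (hΩ_open : IsOpen Ω) (p : V → ℝ) (hp_cont : ContinuousOn p Ω)
    (hp_pos : ∀ z ∈ Ω, 0 < p z) (m : ℕ) :
    (∀ k : ℕ, IsBergmanKernel (hermitianVolume V) Ω (fun z => p z ^ k) (powerKernel Ω p k)) ∧
    IsBergmanKernel (inflatedVolume V m) (inflatedDomain Ω p m) (fun _ => 1)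
      (inflatedBergmanKernel Ω p m) ∧
    (∀ (z w : V) (Z W : EuclideanSpace ℂ (Fin m)),
      (z, Z) ∈ inflatedDomain Ω p m → (w, W) ∈ inflatedDomain Ω p m →
        (∀ᶠ r in 𝓝 (inner ℂ W Z), Summable fun k : ℕ => powerKernel Ω p k z w * r ^ k) ∧
        AnalyticAt ℂ (virtualBergmanKernel Ω p z w) (inner ℂ W Z) ∧
        inflatedBergmanKernel Ω p m (z, Z) (w, W) =
          virtualBergmanDeriv Ω p m z w (inner ℂ W Z) ∧
        HasSum (fun k : ℕ => ((k + m).choose m : ℂ) * powerKernel Ω p (k + m) z w *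
            (inner ℂ W Z) ^ k)
          (inflatedBergmanKernel Ω p m (z, Z) (w, W))) ∧
    (∀ (z : V) (Z : EuclideanSpace ℂ (Fin m)), (z, Z) ∈ inflatedDomain Ω p m →
        inflatedBergmanKernel Ω p m (z, Z) (z, Z) =
          diagVirtualBergmanDeriv Ω p m z (‖Z‖ ^ 2)) := by
  refine ⟨isBergmanKernel_powerKernel hΩ_open hp_cont hp_pos,
    isBergmanKernel_inflatedBergmanKernel hΩ_open hp_cont m, fun z w Z W hz hw => ?_,
    fun z Z hz => inflatedBergmanKernel_self_eq_diagVirtualBergmanDeriv hΩ_open hp_cont hp_pos hz⟩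
  have hinner : ‖inner ℂ W Z‖ < √(p z) * √(p w) :=
    norm_inner_lt_of_mem_hartogsDomain (x := (z, Z)) (y := (w, W)) hz hw
  exact ⟨eventually_summable_mul_pow
      (summable_norm_powerKernel_mul_pow hΩ_open hp_cont hp_pos hz.1 hw.1) hinner,
    analyticAt_virtualBergmanKernel hΩ_open hp_cont hp_pos hz.1 hw.1 hinner,
    inflatedBergmanKernel_eq_virtualBergmanDeriv hΩ_open hp_cont hp_pos hz hw,
    hasSum_inflatedBergmanKernel (x := (z, Z)) (y := (w, W)) hΩ_open hp_cont hp_pos hz hw⟩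

/-- In Mathlib `inner ℂ W Z` is linear in `Z` and conjugate-linear in `W`: it is the Hermitian
product `⟨Z, W⟩ = ∑ j, Z_j * conj W_j`. -/
theorem theorem1 {V : Type*} [NormedAddCommGroup V] [InnerProductSpace ℂ V]
    [FiniteDimensional ℂ V] [MeasurableSpace V] [BorelSpace V]
    (Ω : Set V) (hΩ_open : IsOpen Ω) (hΩ_conn : IsConnected Ω)
    (p : V → ℝ) (hp_cont : ContinuousOn p Ω) (hp_pos : ∀ z ∈ Ω, 0 < p z)
    (m : ℕ) (hm : 1 ≤ m) :
    -- the kernels in question exist, i.e. have the reproducing property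
    (∀ k : ℕ, IsBergmanKernel (hermitianVolume V) Ω (fun z => p z ^ k) (powerKernel Ω p k)) ∧
    IsBergmanKernel (inflatedVolume V m) (inflatedDomain Ω p m) (fun _ => 1)
      (inflatedBergmanKernel Ω p m) ∧
    (∀ (z w : V) (Z W : EuclideanSpace ℂ (Fin m)),
      (z, Z) ∈ inflatedDomain Ω p m → (w, W) ∈ inflatedDomain Ω p m →
        -- the series `L₀(z, w; r)` converges for `r` near `⟨Z, W⟩`, with an analytic sum
        (∀ᶠ r in 𝓝 (inner ℂ W Z), Summable fun k : ℕ => powerKernel Ω p k z w * r ^ k) ∧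
        AnalyticAt ℂ (virtualBergmanKernel Ω p z w) (inner ℂ W Z) ∧
        inflatedBergmanKernel Ω p m (z, Z) (w, W) =
          virtualBergmanDeriv Ω p m z w (inner ℂ W Z) ∧
        HasSum (fun k : ℕ => ((k + m).choose m : ℂ) * powerKernel Ω p (k + m) z w *
            (inner ℂ W Z) ^ k)
          (inflatedBergmanKernel Ω p m (z, Z) (w, W))) ∧
    (∀ (z : V) (Z : EuclideanSpace ℂ (Fin m)), (z, Z) ∈ inflatedDomain Ω p m →
        inflatedBergmanKernel Ω p m (z, Z) (z, Z) =
          diagVirtualBergmanDeriv Ω p m z (‖Z‖ ^ 2)) :=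
  theorem1_general Ω hΩ_open p hp_cont hp_pos m
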